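/- For a finite graph, hypergraph or directed (multi)graph $Q$, the bunkbed structure $\tilde Q$ consists of two disjoint copies $Q_0,Q_1$ of $Q$ (the copies in $Q_i$ of a vertex $v$ and an edge $e$ are written $v^{(i)},e^{(i)}$), together with a vertical edge between $v^{(0)}$ and $v^{(1)}$ for every $v\in V(Q)$ (bidirectional if $Q$ is directed). A percolation model selects a random set of edges of $\tilde Q$, which are retained; write $P(x\to y)$ for the probability that there is a (directed, if $Q$ is directed) path of retained edges from $x$ to $y$. In a hypergraph, consecutive vertices of a path lie in a common hyperedge. The bunkbed conjecture for a model states that $P(u^{(0)}\to v^{(0)})\ge P(u^{(0)}\to v^{(1)})$ for all $Q$ and all $u,v\in V(Q)$. Consider the following models. - $E_1$ (graphs $G$): a set $W\subseteq V(\tilde G)$ is chosen uniformly among all subsets, and the edges with both ends in $W$ are retained. - $E_2^T$ (graphs $G$, $T\subseteq V(G)$): as $E_1$, but $W$ is uniform among the sets containing both $v^{(0)},v^{(1)}$ for $v\in T$ and exactly one of them for $v\notin T$. - $E_4^T$ (hypergraphs $\mathcal H$, $T\subseteq V(\mathcal H)$): the retained set is uniform among those containing exactly one of $e^{(0)},e^{(1)}$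 for each hyperedge $e$, and exactly the vertical edges at the vertices of $T$. - $E_5$ (hypergraphs): the retained set is uniform among all subsets of $E(\tilde{\mathcal H})$. - $E_6^{T,F}$ (digraphs $D$, $T\subseteq V(D)$, $F\subseteq E(D)$): the retained set is uniform among those containing both $e^{(0)},e^{(1)}$ for $e\in F$, exactly one of them for $e\notin F$, and exactly the vertical edges at the vertices of $T$. - $E_7$ (directed multigraphs): the retained set is uniform among all subsets of $E(\tilde D)$. **Theorem 1.** The bunkbed conjecture is false for each of the models $E_1$, $E_2^T$, $E_4^T$, $E_5$, $E_6^{T,F}$ and $E_7$. More precisely, $P(u^{(0)}\to v^{(1)})>P(u^{(0)}\to v^{(0)})$ in each of the following cases. 1. $E_2^{T_2}$ on $G_2$, with $u=v_1$, $v=v_9$. Here $G_2$ is the graph on $v_1,\dots,v_9$ with edges $v_1v_5$, $v_5v_4$, $v_4v_3$, $v_3v_6$, $v_6v_9$, $v_1v_2$, $v_3v_2$, $v_4v_7$, $v_6v_7$, $v_5v_8$, $v_9v_8$, and $T_2=\{v_2,v_7,v_8\}$. 2. $E_1$ on the graph $G_1$ with 105 vertices that is obtained from $G_2$ by blowing up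 each of $v_2,v_7,v_8$ to an independent set of 33 vertices, with $u=v_1$, $v=v_9$. 3. $E_4^{T_4}$ on $\mathcal H_4$, with $u=u_1$, $v=u_{10}$. Here $\mathcal H_4$ is the hypergraph on $u_1,\dots,u_{10}$ with hyperedges $u_1u_2u_3$, $u_3u_4u_9$, $u_4u_5u_7$, $u_5u_6u_2$, $u_6u_8u_7$, $u_8u_{10}u_9$, and $T_4=\{u_2,u_7,u_9\}$. 4. $E_5$ on the hypergraph $\mathcal H_5$ with 316 vertices that is obtained from $\mathcal H_4$ by attaching 102 pendant 2-edges at each vertex of $T_4$, with $u=u_1$, $v=u_{10}$. 5. $E_6^{T_6,F_6}$ on $D_6$, with $u=u_1$, $v=u_{10}$. Here $D_6$ is the digraph obtained from $\mathcal H_4$ by replacing each hyperedge $f$ by two new vertices $x_f,y_f$, the directed edge $x_fy_f$, and the directed edges $ax_f$, $y_fa$ for each $a\in f$; $T_6=T_4$, and $F_6$ consists of all edges of $D_6$ other than the edges $x_fy_f$. 6. $E_7$ on the directed multigraph $D_7$ with 2092 vertices that is obtained from $D_6$ by replacing each edge in $F_6$ by 690 parallel edges, and attaching to each $t\in T_6$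 new vertices $w_{t,1},\dots,w_{t,690}$ with the directed edges $t\,w_{t,j}$ and $w_{t,j}\,t$; with $u=u_1$, $v=u_{10}$. -/

import Mathlib

namespace Bunkbed

/-- Common setting for graphs, hypergraphs and (multi-)digraphs as far as paths are concerned:
a type of edges, and `Joins e x y` says that the edge `e` may be used to step from `x` to `y`. -/
structure Net (V : Type) where
  Edge : Type
  Joins : Edge → V → V → Prop

/-- A directed multigraph with vertex type `V` and edge type `E`. -/
structure MultiDigraph (V E : Type) where
  src : E → V
  tgt : E → V

/-- The set of (directed) edges of a digraph, as a type. -/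
abbrev DEdge {V : Type} (D : Digraph V) : Type := {p : V × V // D.Adj p.1 p.2}

/-- A graph: an edge may be traversed between its two ends, in both directions. -/
def ofGraph {V : Type} (G : SimpleGraph V) : Net V where
  Edge := G.edgeSet
  Joins e x y := e.1 = s(x, y)

/-- A hypergraph: consecutive vertices of a path are members of a common hyperedge. -/
def ofHypergraph {α : Type} (H : Hypergraph α) : Net H.vertexSet where
  Edge := H.edgeSet
  Joins e x y := x.1 ∈ e.1 ∧ y.1 ∈ e.1

/-- A digraph: edges are traversed from tail to head. -/
def ofDigraph {V : Type} (D : Digraph V) : Net V where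
  Edge := DEdge D
  Joins e x y := e.1 = (x, y)

/-- A directed multigraph: edges are traversed from tail to head. -/
def ofMultiDigraph {V E : Type} (D : MultiDigraph V E) : Net V where
  Edge := E
  Joins e x y := D.src e = x ∧ D.tgt e = y

/-- The edges of the bunkbed structure: `Sum.inl (e, i)` is the horizontal edge `e⁽ⁱ⁾`, and
`Sum.inr v` is the vertical edge between `v⁽⁰⁾` and `v⁽¹⁾`. -/
abbrev BEdge {V : Type} (Q : Net V) : Type := (Q.Edge × Fin 2) ⊕ V

/-- The bunkbed structure over `Q`; the vertex `v⁽ⁱ⁾` is `(v, i)`. Vertical edges can be traversed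
in both directions. -/
def bunkbed {V : Type} (Q : Net V) : Net (V × Fin 2) where
  Edge := BEdge Q
  Joins e x y :=
    match e with
    | Sum.inl (e, i) => x.2 = i ∧ y.2 = i ∧ Q.Joins e x.1 y.1
    | Sum.inr v => x.1 = v ∧ y.1 = v ∧ x.2 ≠ y.2

/-- There is a path from `x` to `y` in `N` all of whose edges belong to `X`. -/
def Conn {V : Type} (N : Net V) (X : Set N.Edge) (x y : V) : Prop :=
  Relation.ReflTransGen (fun a b => ∃ e ∈ X, N.Joins e a b) x y

/-- The two ends of an edge (for graphs), or the members of a hyperedge. -/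
def ends {V : Type} (N : Net V) (e : N.Edge) : Set V :=
  {x | ∃ y, N.Joins e x y ∨ N.Joins e y x}

/-- A percolation model: an element of the finite family `outcomes` is chosen uniformly at
random, and it determines the set of retained edges. For bond percolation the outcomes are sets
of edges, for site percolation they are sets of open vertices. -/
structure Model {V : Type} (N : Net V) where
  Outcome : Type
  outcomes : Set Outcome
  retained : Outcome → Set N.Edge

/-- The probability, under the uniform distribution on the family `outcomes`, that there is a
path of retained edges from `x` to `y`. -/
noncomputable def Model.prob {V : Type} {N : Net V} (M : Model N) (x y : V) : ℚ :=
  (Set.ncard {ω ∈ M.outcomes | Conn N (M.retained ω) x y} : ℚ) / (Set.ncard M.outcomes : ℚ)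

/-- The bunkbed conjecture for a given model on a given `Q`. -/
def BunkbedConjecture {V : Type} {Q : Net V} (M : Model (bunkbed Q)) : Prop :=
  ∀ u v : V, M.prob (u, 0) (v, 0) ≥ M.prob (u, 0) (v, 1)

/-! ### The models -/

/-- Site percolation: the outcomes are sets of open vertices, and precisely the edges with both
ends open are retained. -/
def siteModel {V : Type} (G : SimpleGraph V) (𝒲 : Set (Set (V × Fin 2))) :
    Model (bunkbed (ofGraph G)) where
  Outcome := Set (V × Fin 2)
  outcomes := 𝒲
  retained W := {e | ends (bunkbed (ofGraph G)) e ⊆ W}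

/-- Bond percolation: the outcomes are the sets of retained edges. -/
def bondModel {V : Type} (Q : Net V) (𝓔 : Set (Set (BEdge Q))) : Model (bunkbed Q) where
  Outcome := Set (BEdge Q)
  outcomes := 𝓔
  retained X := X

/-- Unconditioned site percolation: all sets of open vertices are allowed. -/
def E1 {V : Type} (G : SimpleGraph V) : Model (bunkbed (ofGraph G)) :=
  siteModel G Set.univ

/-- Conditioned site percolation: both copies of each `v ∈ T` are open, and precisely one copy of
each `v ∉ T` is open. -/
def E2 {V : Type} (G : SimpleGraph V) (T : Set V) : Model (bunkbed (ofGraph G)) :=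
  siteModel G {W | ∀ v, (v ∈ T → (v, 0) ∈ W ∧ (v, 1) ∈ W) ∧
    (v ∉ T → Xor ((v, 0) ∈ W) ((v, 1) ∈ W))}

/-- Conditioned hypergraphs: precisely one copy of each hyperedge is retained, and the retained
vertical edges are those at `T`. -/
def E4 {α : Type} (H : Hypergraph α) (T : Set H.vertexSet) : Model (bunkbed (ofHypergraph H)) :=
  bondModel (ofHypergraph H) {X |
    (∀ e : H.edgeSet, Xor (Sum.inl (e, 0) ∈ X) (Sum.inl (e, 1) ∈ X)) ∧
    (∀ v, Sum.inr v ∈ X ↔ v ∈ T)}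

/-- Unconditioned hypergraphs. -/
def E5 {α : Type} (H : Hypergraph α) : Model (bunkbed (ofHypergraph H)) :=
  bondModel (ofHypergraph H) Set.univ

/-- Conditioned digraphs: both copies of each `e ∈ F` and precisely one copy of each edge `e ∉ F`
are retained, and the retained vertical edges are those at `T`. -/
def E6 {V : Type} (D : Digraph V) (T : Set V) (F : Set (DEdge D)) :
    Model (bunkbed (ofDigraph D)) :=
  bondModel (ofDigraph D) {X |
    (∀ e : DEdge D, (e ∈ F → Sum.inl (e, 0) ∈ X ∧ Sum.inl (e, 1) ∈ X) ∧
      (e ∉ F → Xor (Sum.inl (e, 0) ∈ X) (Sum.inl (e, 1) ∈ X))) ∧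
    (∀ v, Sum.inr v ∈ X ↔ v ∈ T)}

/-- Unconditioned directed multigraphs. -/
def E7 {V E : Type} (D : MultiDigraph V E) : Model (bunkbed (ofMultiDigraph D)) :=
  bondModel (ofMultiDigraph D) Set.univ

/-! ### The counterexamples -/

/-- The graph `G₂`; the vertex `v_j` is `j - 1 : Fin 9`. The vertices outside `T2` induce the path
`v₁ v₅ v₄ v₃ v₆ v₉`, and each of them has one neighbour in `T2`. -/
def G2 : SimpleGraph (Fin 9) :=
  SimpleGraph.fromEdgeSet
    {s(0, 4), s(4, 3), s(3, 2), s(2, 5), s(5, 8),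
      s(0, 1), s(2, 1), s(3, 6), s(5, 6), s(4, 7), s(8, 7)}

/-- `T₂ = {v₂, v₇, v₈}`. -/
def T2 : Set (Fin 9) := {1, 6, 7}

/-- The vertices of the blow-up of the vertices in `T` to `k` vertices each. -/
abbrev BlowUpVertex {V : Type} (T : Set V) (k : ℕ) : Type := (Tᶜ : Set V) ⊕ (T × Fin k)

/-- The vertex from which a vertex of the blow-up arises. -/
def blowUpProj {V : Type} (T : Set V) (k : ℕ) : BlowUpVertex T k → V
  | Sum.inl v => v.1
  | Sum.inr p => p.1.1

/-- The blow-up of each vertex in `T` to an empty graph on `k` vertices. -/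
def blowUp {V : Type} (G : SimpleGraph V) (T : Set V) (k : ℕ) : SimpleGraph (BlowUpVertex T k) :=
  G.comap (blowUpProj T k)

/-- The graph `G₁`. -/
def G1 : SimpleGraph (BlowUpVertex T2 33) := blowUp G2 T2 33

/-- The vertex `v₁` of `G₁`. -/
def G1start : BlowUpVertex T2 33 := Sum.inl ⟨0, by simp [T2]⟩

/-- The vertex `v₉` of `G₁`. -/
def G1target : BlowUpVertex T2 33 := Sum.inl ⟨8, by simp [T2]⟩

/-- The 3-uniform hypergraph `H₄`; the vertex `u_j` is `j - 1 : Fin 10`. The hyperedges correspond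
to `v₁, v₅, v₄, v₃, v₆, v₉` in this order. -/
def H4 : Hypergraph (Fin 10) where
  vertexSet := Set.univ
  edgeSet := {{0, 1, 2}, {2, 3, 8}, {3, 4, 6}, {4, 5, 1}, {5, 7, 6}, {7, 9, 8}}
  subset_vertexSet_of_mem_edgeSet' := fun _ _ => Set.subset_univ _

/-- `T₄ = {u₂, u₇, u₉}`, as a set of elements of `Fin 10`. -/
def T4 : Set (Fin 10) := {1, 6, 8}

/-- The hypergraph `H₅`: `H₄` with `k = 102` pendant 2-edges attached at each vertex of `T₄`. -/
def H5 : Hypergraph (Fin 10 ⊕ (T4 × Fin 102)) where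
  vertexSet := Set.univ
  edgeSet := {e | ∃ f ∈ H4.edgeSet, e = Sum.inl '' f} ∪
    {e | ∃ (t : T4) (i : Fin 102), e = {Sum.inl t.1, Sum.inr (t, i)}}
  subset_vertexSet_of_mem_edgeSet' := fun _ _ => Set.subset_univ _

/-- The vertices of `D₆`: those of `H₄`, and new vertices `x_f`, `y_f` for each hyperedge `f`. -/
inductive D6Vertex : Type
  | old (u : Fin 10)
  | x (f : H4.edgeSet)
  | y (f : H4.edgeSet)

/-- The directed edges of `D₆`: `u x_f` and `y_f u` for `u ∈ f`, and `x_f y_f`. -/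
inductive D6Adj : D6Vertex → D6Vertex → Prop
  | enter (u : Fin 10) (f : H4.edgeSet) : u ∈ f.1 → D6Adj (.old u) (.x f)
  | middle (f : H4.edgeSet) : D6Adj (.x f) (.y f)
  | leave (u : Fin 10) (f : H4.edgeSet) : u ∈ f.1 → D6Adj (.y f) (.old u)

/-- The digraph `D₆`. -/
def D6 : Digraph D6Vertex where
  Adj := D6Adj

/-- `T₆`, the copy of `T₄` in `D₆`. -/
def T6 : Set D6Vertex := D6Vertex.old '' T4

/-- `F₆`, the edges of `D₆` other than the edges `x_f y_f`. -/
def F6 : Set (DEdge D6) := {e | ∀ f, e.1 ≠ (D6Vertex.x f, D6Vertex.y f)}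

/-- The vertices of `attachGadgets D T F k`. -/
abbrev GadgetVertex {V : Type} (T : Set V) (k : ℕ) : Type := V ⊕ (T × Fin k)

/-- The edges of `attachGadgets D T F k`. -/
abbrev GadgetEdge {V : Type} (D : Digraph V) (T : Set V) (F : Set (DEdge D)) (k : ℕ) : Type :=
  ((Fᶜ : Set (DEdge D)) ⊕ (F × Fin k)) ⊕ ((T × Fin k) ⊕ (T × Fin k))

/-- Replace each edge in `F` by `k` parallel edges, keep the other edges of `D`, and attach to
each `t ∈ T` new vertices `w_{t,j}`, for `j ∈ Fin k`, with directed edges `t w_{t,j}` and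
`w_{t,j} t`. -/
def attachGadgets {V : Type} (D : Digraph V) (T : Set V) (F : Set (DEdge D)) (k : ℕ) :
    MultiDigraph (GadgetVertex T k) (GadgetEdge D T F k) where
  src
    | Sum.inl (Sum.inl e) => Sum.inl e.1.1.1
    | Sum.inl (Sum.inr p) => Sum.inl p.1.1.1.1
    | Sum.inr (Sum.inl p) => Sum.inl p.1.1
    | Sum.inr (Sum.inr p) => Sum.inr p
  tgt
    | Sum.inl (Sum.inl e) => Sum.inl e.1.1.2
    | Sum.inl (Sum.inr p) => Sum.inl p.1.1.1.2
    | Sum.inr (Sum.inl p) => Sum.inr p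
    | Sum.inr (Sum.inr p) => Sum.inl p.1.1

/-- The directed multigraph `D₇`. -/
def D7 : MultiDigraph (GadgetVertex T6 690) (GadgetEdge D6 T6 F6 690) :=
  attachGadgets D6 T6 F6 690

/-- The vertex `u` of `H₄`. -/
def H4vertex (u : Fin 10) : H4.vertexSet := ⟨u, Set.mem_univ u⟩

/-- The vertex of `H₅` which is the copy of the vertex `u` of `H₄`. -/
def H5vertex (u : Fin 10) : H5.vertexSet := ⟨Sum.inl u, Set.mem_univ _⟩

end Bunkbed

namespace Bunkbed

/-! ### Chains of three-element cells -/

/-! All six counterexamples are the same object: six cells strung along a path with seven vertices,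
each cell containing in addition one of three posts, and each post lying in two cells. A cell is a
hyperedge of `H4`, an edge `x_f y_f` of `D6` together with the edges entering and leaving it, or a
vertex of `G2` outside `T2`. The posts are the elements of the set `T`, where the layer can be
changed. Everything else that is random is recorded in a `ChainState`, and the question is in which
layer the end of the path is reached.

Suppose that some vertex of the path has a vertical edge or that some cell has the same middle edges
in both layers. Exchanging the layers of all cells behind this place is an involution of the set of
such states, and it turns connections to layer 0 of the last vertex into connections to layer 1
(`ChainState.Reach.flip`, `exists_layer_exchange`). Hence these states do not favour layer 0, and
only the states without such a cut have to be compared (`ncard_hits_le_of_not_cut`). In those, every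
cell has exactly one middle edge: there are `2 ^ 6` of them in the undirected case, and `2 ^ 18` in
the directed case, where a cell may also have vertical edges at its entrance and its exit. A finite
count shows that layer 1 wins by at least 1 and by at least 4 states, respectively
(`ncard_not_cut_hits_undirected`, `ncard_hits_directed`).

In the conditioned models the outcomes correspond to the `2 ^ 6` states. In the unconditioned
models, each post gets many independent chances to allow a change of layer, and for `D7` each edge
of `F6` gets many parallel copies. With overwhelming probability every post works and every such
edge is present, and then the state of the chain is a function of a uniformly random set of a few
core edges or vertices. The exceptional probability is smaller than the advantage of layer 1
(`ncard_lt_ncard_of_core`). -/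

/-- The vertices of a chain of six cells: the seven vertices of a path, and three posts. -/
abbrev ChainVertex : Type := Fin 7 ⊕ Fin 3

/-- The post contained in a cell. -/
def cellPost : Fin 6 → Fin 3 := ![0, 1, 2, 0, 2, 1]

/-- Each cell consists of two consecutive vertices of the path and of a post. -/
def ChainMem (j : Fin 6) (v : ChainVertex) : Prop :=
  v = .inl j.castSucc ∨ v = .inl j.succ ∨ v = .inr (cellPost j)

instance (j : Fin 6) (v : ChainVertex) : Decidable (ChainMem j v) := by
  unfold ChainMem; infer_instance

theorem chainMem_inr {j : Fin 6} {t : Fin 3} : ChainMem j (.inr t) ↔ t = cellPost j := by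
  simp [ChainMem]

/-- The state of a cell: the layers in which its middle edge is retained, and whether its entrance
and its exit have a vertical edge. -/
abbrev CellState : Type := (Fin 2 → Bool) × Bool × Bool

/-- A cell can be traversed from layer `l` to layer `m`. -/
def CellState.Passes (c : CellState) (l m : Fin 2) : Prop :=
  ∃ k, (l = k ∨ c.2.1 = true) ∧ c.1 k = true ∧ (k = m ∨ c.2.2 = true)

/-- The middle edge of the cell is retained in both layers or in none. -/
def CellState.Balanced (c : CellState) : Prop := c.1 0 = c.1 1

/-- Exchange the layers of a cell if `b = 1`. -/
def CellState.flip (b : Fin 2) (c : CellState) : CellState := (fun l => c.1 (l + b), c.2)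

theorem fin2_add_add (l b : Fin 2) : l + b + b = l := by revert l b; decide

theorem CellState.flip_flip (b : Fin 2) (c : CellState) : (c.flip b).flip b = c := by
  simp [CellState.flip, fin2_add_add]

theorem CellState.flip_balanced {b : Fin 2} {c : CellState} :
    (c.flip b).Balanced ↔ c.Balanced := by
  unfold CellState.Balanced CellState.flip
  revert b; simp [Fin.forall_fin_two, eq_comm]

theorem CellState.Balanced.flip_eq {b : Fin 2} {c : CellState} (h : c.Balanced) :
    c.flip b = c := by
  obtain ⟨c, d⟩ := c
  simp only [CellState.Balanced] at h
  refine Prod.ext (funext fun l => ?_) rfl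
  revert b l; simp [CellState.flip, Fin.forall_fin_two, h]

theorem CellState.Passes.flip {c : CellState} {l m : Fin 2} (h : c.Passes l m) (b : Fin 2) :
    (c.flip b).Passes (l + b) (m + b) := by
  obtain ⟨k, h1, h2, h3⟩ := h
  exact ⟨k + b, by simpa [CellState.flip] using h1, by simpa [CellState.flip, fin2_add_add] using h2,
    by simpa [CellState.flip] using h3⟩

/-- The states of the cells, and the vertices of the path that have a vertical edge. -/
abbrev ChainState : Type := (Fin 6 → CellState) × (Fin 7 → Bool)

/-- The vertices at which one can change the layer; this is always possible at posts. -/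
def ChainState.Vert (s : ChainState) : ChainVertex → Prop
  | .inl q => s.2 q = true
  | .inr _ => True

/-- The steps through a cell or along a vertical edge. -/
def ChainState.Step (s : ChainState) (p q : ChainVertex × Fin 2) : Prop :=
  (∃ j, ChainMem j p.1 ∧ ChainMem j q.1 ∧ (s.1 j).Passes p.2 q.2) ∨ (p.1 = q.1 ∧ s.Vert p.1)

def ChainState.Reach (s : ChainState) : ChainVertex × Fin 2 → ChainVertex × Fin 2 → Prop :=
  Relation.ReflTransGen s.Step

/-- The last vertex of the path in layer `i` can be reached from the first in layer `0`. -/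
def ChainState.Hits (s : ChainState) (i : Fin 2) : Prop := s.Reach (.inl 0, 0) (.inl 6, i)

/-! ### Exchanging layers behind a cut -/

def ChainState.flip (f : Fin 6 → Fin 2) (s : ChainState) : ChainState :=
  (fun j => (s.1 j).flip (f j), s.2)

theorem ChainState.flip_flip (f : Fin 6 → Fin 2) (s : ChainState) : (s.flip f).flip f = s := by
  simp [ChainState.flip, CellState.flip_flip]

/-- Think of `g v` as the shift of layers at the vertex `v` and of `f j` as the shift inside the
cell `j`. A path can be shifted step by step unless the two shifts disagree where a cell meets a
vertex. A disagreement is harmless if the layer can be changed at the vertex, or if the cell looks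
the same in both layers. -/
theorem ChainState.Reach.flip {s : ChainState} {f : Fin 6 → Fin 2} {g : ChainVertex → Fin 2}
    (h : ∀ j v, ChainMem j v → s.Vert v ∨ g v = f j ∨ (s.1 j).Balanced)
    {p q : ChainVertex × Fin 2} (hr : s.Reach p q) :
    (s.flip f).Reach (p.1, p.2 + g p.1) (q.1, q.2 + g q.1) := by
  have hvert : ∀ v l m, s.Vert v → (s.flip f).Step (v, l) (v, m) := by
    intro v l m hv
    refine Or.inr ⟨rfl, ?_⟩
    cases v <;> exact hv
  have hcell : ∀ j x y l m, ChainMem j x → ChainMem j y → ((s.flip f).1 j).Passes l m →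
      (s.flip f).Step (x, l) (y, m) := fun j x y l m hx hy hp => Or.inl ⟨j, hx, hy, hp⟩
  induction hr with
  | refl => exact .refl
  | @tail b c _ hbc ih =>
    refine ih.trans ?_
    obtain ⟨x, l⟩ := b
    obtain ⟨y, m⟩ := c
    rcases hbc with ⟨j, hx, hy, hp⟩ | ⟨hxy, hv⟩
    · by_cases hb : (s.1 j).Balanced
      · have hp' : ∀ b, ((s.flip f).1 j).Passes (l + b) (m + b) := by
          intro b
          have := hp.flip b
          rw [hb.flip_eq] at this
          simpa [ChainState.flip, hb.flip_eq] using this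
        -- A balanced cell is crossed twice: first to its post with the shift of `x`, then, after a
        -- change of layer at the post, to `y` with the shift of `y`.
        have ht : ChainMem j (.inr (cellPost j)) := Or.inr (Or.inr rfl)
        refine .head (hcell j _ _ _ _ hx ht (hp' (g x))) ?_
        refine .head (hvert _ _ (l + g y) trivial) ?_
        exact .single (hcell j _ _ _ _ ht hy (hp' (g y)))
      · have hx' : (s.flip f).Reach (x, l + g x) (x, l + f j) := by
          rcases h j x hx with h1 | h1 | h1
          · exact .single (hvert _ _ _ h1)
          · rw [h1]; exact .refl
          · exact absurd h1 hb
        have hy' : (s.flip f).Reach (y, m + f j) (y, m + g y) := by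
          rcases h j y hy with h1 | h1 | h1
          · exact .single (hvert _ _ _ h1)
          · rw [h1]; exact .refl
          · exact absurd h1 hb
        exact (hx'.tail (hcell j _ _ _ _ hx hy (hp.flip (f j)))).trans hy'
    · simp only at hxy
      subst hxy
      exact .single (hvert _ _ _ hv)

/-- A vertical edge at a vertex of the path, or a balanced cell, allows us to exchange the layers
of everything behind it. -/
theorem exists_layer_exchange (vert : Fin 7 → Prop) (bal : Fin 6 → Prop)
    (h : (∃ q, vert q) ∨ ∃ c, bal c) :
    ∃ (f : Fin 6 → Fin 2) (g : ChainVertex → Fin 2), g (.inl 0) = 0 ∧ g (.inl 6) = 1 ∧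
      ∀ j v, ChainMem j v → (∃ q, v = .inl q ∧ vert q) ∨ (∃ t, v = .inr t) ∨ g v = f j ∨ bal j := by
  rcases h with ⟨q, hq⟩ | ⟨c, hc⟩
  -- The condition `p ≠ 0` matters only for `q = 0`: then all cells are exchanged, but the starting
  -- point must keep its layer.
  · refine ⟨fun j => if q ≤ j.castSucc then 1 else 0,
      Sum.elim (fun p => if q ≤ p ∧ p ≠ 0 then 1 else 0) 0, by simp, ?_, ?_⟩
    · simp only [Sum.elim_inl]; clear hq; revert q; decide
    · rintro j v (rfl | rfl | rfl)
      · by_cases hj : q = j.castSucc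
        · subst hj; exact Or.inl ⟨_, rfl, hq⟩
        · refine Or.inr (Or.inr (Or.inl ?_))
          revert hj; clear hq; revert q j; decide
      · by_cases hj : q = j.succ
        · subst hj; exact Or.inl ⟨_, rfl, hq⟩
        · refine Or.inr (Or.inr (Or.inl ?_))
          revert hj; clear hq; revert q j; decide
      · exact Or.inr (Or.inl ⟨_, rfl⟩)
  -- Here the shift changes inside the cell `c`: its left end is not shifted, its right end is.
  · refine ⟨fun j => if c < j then 1 else 0,
      Sum.elim (fun p => if c.castSucc < p then 1 else 0) 0, by simp, ?_, ?_⟩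
    · simp only [Sum.elim_inl]; clear hc; revert c; decide
    · rintro j v (rfl | rfl | rfl)
      · exact Or.inr (Or.inr (Or.inl (by simp)))
      · by_cases hj : j = c
        · subst hj; exact Or.inr (Or.inr (Or.inr hc))
        · refine Or.inr (Or.inr (Or.inl ?_))
          revert hj; clear hc; revert c j; decide
      · exact Or.inr (Or.inl ⟨_, rfl⟩)

/-- A state in which some exchange of layers preserves connections to the first vertex. -/
def ChainState.Cut (s : ChainState) : Prop :=
  (∃ q, s.2 q = true) ∨ ∃ j, (s.1 j).Balanced

/-- The number of states with prescribed vertical edges in which the last vertex is hit in layer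
`0` or `1`, respectively, can be compared by looking at the states without a cut. -/
theorem ncard_hits_le_of_not_cut (K : (Fin 6 → Bool × Bool) → (Fin 7 → Bool) → Prop) (m : ℕ)
    (h : {s : ChainState | K (fun j => (s.1 j).2) s.2 ∧ ¬ s.Cut ∧ s.Hits 0}.ncard + m ≤
      {s : ChainState | K (fun j => (s.1 j).2) s.2 ∧ ¬ s.Cut ∧ s.Hits 1}.ncard) :
    {s : ChainState | K (fun j => (s.1 j).2) s.2 ∧ s.Hits 0}.ncard + m ≤
      {s : ChainState | K (fun j => (s.1 j).2) s.2 ∧ s.Hits 1}.ncard := by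
  choose! f g h0 h6 hfg using exists_layer_exchange
  -- The exchange is chosen in terms of the vertical edges on the path and the set of balanced cells
  -- only. Both are invariant under exchanges, so `F` undoes itself.
  let F : ChainState → ChainState :=
    fun s => s.flip (f (fun q => s.2 q = true) (fun j => (s.1 j).Balanced))
  have hbal : ∀ s, (fun j => ((F s).1 j).Balanced) = fun j => (s.1 j).Balanced := by
    intro s; funext j; exact propext CellState.flip_balanced
  have hF : ∀ s, F (F s) = s := by
    intro s
    change (F s).flip (f (fun q => s.2 q = true) (fun j => ((F s).1 j).Balanced)) = s
    rw [hbal]; exact s.flip_flip _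
  have hcutF : ∀ s, (F s).Cut ↔ s.Cut := by
    intro s
    change (_ ∨ ∃ j, (fun j => ((F s).1 j).Balanced) j) ↔ _
    rw [hbal]; rfl
  have hle : {s : ChainState | K (fun j => (s.1 j).2) s.2 ∧ s.Cut ∧ s.Hits 0}.ncard ≤
      {s : ChainState | K (fun j => (s.1 j).2) s.2 ∧ s.Cut ∧ s.Hits 1}.ncard := by
    refine Set.ncard_le_ncard_of_injOn F ?_ (fun a _ b _ hab => ?_) (Set.toFinite _)
    · rintro s ⟨hK, hc, hh⟩
      refine ⟨hK, (hcutF s).2 hc, ?_⟩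
      have := ChainState.Reach.flip (s := s) (f := f (fun q => s.2 q = true) (fun j => (s.1 j).Balanced))
        (g := g (fun q => s.2 q = true) (fun j => (s.1 j).Balanced)) ?_ hh
      · rw [h0 _ _ hc, h6 _ _ hc] at this
        exact this
      · intro j v hv
        rcases hfg _ _ hc j v hv with ⟨q, rfl, hq⟩ | ⟨t, rfl⟩ | hq
        · exact Or.inl hq
        · exact Or.inl trivial
        · exact Or.inr hq
    · rw [← hF a, ← hF b, hab]
  have hsplit : ∀ i, {s : ChainState | K (fun j => (s.1 j).2) s.2 ∧ s.Hits i}.ncard =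
      {s : ChainState | K (fun j => (s.1 j).2) s.2 ∧ s.Cut ∧ s.Hits i}.ncard +
      {s : ChainState | K (fun j => (s.1 j).2) s.2 ∧ ¬ s.Cut ∧ s.Hits i}.ncard := by
    intro i
    rw [← Set.ncard_union_eq ?_ (Set.toFinite _) (Set.toFinite _)]
    · congr 1; ext s; simp only [Set.mem_ofPred_eq, Set.mem_union]; tauto
    · rw [Set.disjoint_left]; rintro s ⟨_, h1, _⟩ ⟨_, h2, _⟩; exact h2 h1
  rw [hsplit, hsplit]; omega

/-! ### Bit-sliced computation of connections

Bit `n` of the numbers below refers to the `n`-th member of a family of states of the chain in which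
each cell has precisely one middle edge, and no vertex of the path has a vertical edge. -/

/-- The `n`-th state: bit `n` of `L j`, `X j`, `Y j` is the layer of the middle edge of the cell
`j`, and the presence of the vertical edges at its entrance and its exit. -/
def slicedState (L X Y : Fin 6 → ℕ) (n : ℕ) : ChainState :=
  (fun j => (fun l => (L j).testBit n == (l == 1), (X j).testBit n, (Y j).testBit n),
    fun _ => false)

/-- The states in which the cell `j` can be entered (or left, if `X` is replaced by `Y`) at a given
vertex and layer. -/
def portBits (ones : ℕ) (L X : Fin 6 → ℕ) (j : Fin 6) : ChainVertex → Fin 2 → ℕ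
  | .inl _, l => if l = 0 then (ones ^^^ L j) ||| X j else L j ||| X j
  | .inr _, _ => ones

/-- The states in which the cell `j` can be entered at a vertex of the set described by `ρ`. -/
def hitBits (ones : ℕ) (L X : Fin 6 → ℕ) (ρ : ChainVertex → Fin 2 → ℕ) (j : Fin 6) : ℕ :=
  let at' := fun v => (ρ v 0 &&& portBits ones L X j v 0) ||| (ρ v 1 &&& portBits ones L X j v 1)
  at' (.inl j.castSucc) ||| (at' (.inl j.succ) ||| at' (.inr (cellPost j)))

/-- Add the vertices which can be reached by passing through the cell `j`. -/
def cellStep (ones : ℕ) (L X Y : Fin 6 → ℕ) (ρ : ChainVertex → Fin 2 → ℕ) (j : Fin 6) :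
    ChainVertex → Fin 2 → ℕ :=
  fun v l => if ChainMem j v then ρ v l ||| (hitBits ones L X ρ j &&& portBits ones L Y j v l)
    else ρ v l

/-- The states in which a vertex can be reached by passing through the cells of a list in turn. -/
def reachBits (ones : ℕ) (L X Y : Fin 6 → ℕ) : List (Fin 6) → ChainVertex → Fin 2 → ℕ
  | [] => fun v l => if v = .inl 0 ∧ l = 0 then ones else 0
  | j :: js => cellStep ones L X Y (reachBits ones L X Y js) j

section

variable {ones : ℕ} {L X Y : Fin 6 → ℕ} {n : ℕ}

theorem testBit_portBits_inl (hn : ones.testBit n = true) (j : Fin 6) (q : Fin 7) (l : Fin 2) :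
    (portBits ones L X j (.inl q) l).testBit n = true ↔
      ((L j).testBit n == (l == 1)) = true ∨ (X j).testBit n = true := by
  revert l
  simp [Fin.forall_fin_two, portBits, hn]

theorem testBit_hitBits (ρ : ChainVertex → Fin 2 → ℕ) (j : Fin 6) :
    (hitBits ones L X ρ j).testBit n = true ↔ ∃ v l, ChainMem j v ∧ (ρ v l).testBit n = true ∧
      (portBits ones L X j v l).testBit n = true := by
  simp only [hitBits, Nat.testBit_or, Nat.testBit_and, Bool.or_eq_true, Bool.and_eq_true]
  constructor
  · rintro ((h | h) | (h | h) | (h | h))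
    exacts [⟨_, _, .inl rfl, h⟩, ⟨_, _, .inl rfl, h⟩, ⟨_, _, .inr (.inl rfl), h⟩,
      ⟨_, _, .inr (.inl rfl), h⟩, ⟨_, _, .inr (.inr rfl), h⟩, ⟨_, _, .inr (.inr rfl), h⟩]
  · rintro ⟨v, l, hv, h⟩
    have hl : l = 0 ∨ l = 1 := by omega
    rcases hv with rfl | rfl | rfl <;> rcases hl with rfl | rfl <;> simp [h]

theorem exists_middle_layer (j : Fin 6) : ∃ k : Fin 2, ∀ l : Fin 2,
    ((L j).testBit n == (l == 1)) = true ↔ l = k := by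
  cases h : (L j).testBit n
  · exact ⟨0, by decide⟩
  · exact ⟨1, by decide⟩

/-- Soundness: every bit set by a sweep comes from an actual path. At a post all ports count as open
because the layer can be adjusted there before entering or after leaving the cell. -/
theorem reach_of_testBit_reachBits (hn : ones.testBit n = true) (js : List (Fin 6))
    (v : ChainVertex) (l : Fin 2) (h : (reachBits ones L X Y js v l).testBit n = true) :
    (slicedState L X Y n).Reach (.inl 0, 0) (v, l) := by
  induction js generalizing v l with
  | nil =>
    simp only [reachBits] at h
    split_ifs at h with h1
    · rw [h1.1, h1.2]; exact .refl
    · simp at h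
  | cons j js ih =>
    simp only [reachBits, cellStep] at h
    split_ifs at h with hv
    · rw [Nat.testBit_or, Nat.testBit_and, Bool.or_eq_true, Bool.and_eq_true] at h
      rcases h with h | ⟨h1, h2⟩
      · exact ih _ _ h
      · obtain ⟨w, m, hw, h3, h4⟩ := (testBit_hitBits _ _).1 h1
        obtain ⟨k, hk⟩ := exists_middle_layer (L := L) (n := n) j
        have hpost : ∀ t a b, (slicedState L X Y n).Step (.inr t, a) (.inr t, b) :=
          fun t a b => Or.inr ⟨rfl, trivial⟩
        have hcell : ∀ a b, (a = k ∨ (X j).testBit n = true) → (k = b ∨ (Y j).testBit n = true) →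
            (slicedState L X Y n).Step (w, a) (v, b) := fun a b ha hb =>
          Or.inl ⟨j, hw, hv, k, ha, (hk k).2 rfl, hb⟩
        have hin : ∃ a, (slicedState L X Y n).Reach (w, m) (w, a) ∧
            (a = k ∨ (X j).testBit n = true) := by
          rcases w with q | t
          · rw [testBit_portBits_inl hn, hk] at h4
            exact ⟨m, .refl, h4⟩
          · exact ⟨k, .single (hpost _ _ _), .inl rfl⟩
        have hout : ∃ b, (slicedState L X Y n).Reach (v, b) (v, l) ∧
            (k = b ∨ (Y j).testBit n = true) := by
          rcases v with q | t
          · rw [testBit_portBits_inl hn, hk] at h2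
            exact ⟨l, .refl, h2.imp_left Eq.symm⟩
          · exact ⟨k, .single (hpost _ _ _), .inl rfl⟩
        obtain ⟨a, ha, ha'⟩ := hin
        obtain ⟨b, hb, hb'⟩ := hout
        exact (((ih _ _ h3).trans ha).tail (hcell a b ha' hb')).trans hb
    · exact ih _ _ h

/-- Completeness: a family of sets that contains the start and is stable under passing through any
cell, and under changes of layer at posts, contains everything reachable. It suffices to check
stability after the computation, so nothing has to be proved about the order of the cells. -/
theorem testBit_of_reach (hn : ones.testBit n = true) {ρ : ChainVertex → Fin 2 → ℕ}
    (h0 : (ρ (.inl 0) 0).testBit n = true) (hpost : ∀ t, ρ (.inr t) 0 = ρ (.inr t) 1)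
    (hρ : ∀ j v l, cellStep ones L X Y ρ j v l = ρ v l) {p : ChainVertex × Fin 2}
    (h : (slicedState L X Y n).Reach (.inl 0, 0) p) : (ρ p.1 p.2).testBit n = true := by
  induction h with
  | refl => exact h0
  | @tail b c _ hbc ih =>
    obtain ⟨w, m⟩ := b
    obtain ⟨v, l⟩ := c
    rcases hbc with ⟨j, hw, hv, k, h1, h2, h3⟩ | ⟨h1, h2⟩
    · obtain ⟨k', hk'⟩ := exists_middle_layer (L := L) (n := n) j
      have hkk : k = k' := (hk' k).1 h2
      subst hkk
      simp only
      rw [← hρ j v l]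
      simp only [cellStep]
      rw [if_pos hv, Nat.testBit_or, Nat.testBit_and, Bool.or_eq_true, Bool.and_eq_true]
      refine Or.inr ⟨(testBit_hitBits _ _).2 ⟨w, m, hw, ih, ?_⟩, ?_⟩
      · rcases w with q | t
        · rw [testBit_portBits_inl hn, hk']; exact h1
        · exact hn
      · rcases v with q | t
        · rw [testBit_portBits_inl hn, hk']; exact h3.imp_left Eq.symm
        · exact hn
    · simp only at h1 h2 ih ⊢
      subst h1
      rcases w with q | t
      · exact absurd h2 (by simp [ChainState.Vert, slicedState])
      · have hm : m = 0 ∨ m = 1 := by omega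
        have hl : l = 0 ∨ l = 1 := by omega
        rcases hm with rfl | rfl <;> rcases hl with rfl | rfl <;> simp_all

/-- The hypothesis says that passing through further cells reaches no new vertices. -/
theorem hits_slicedState_iff {js : List (Fin 6)}
    (hjs : (∀ t, reachBits ones L X Y js (.inr t) 0 = reachBits ones L X Y js (.inr t) 1) ∧
      ∀ j v l, cellStep ones L X Y (reachBits ones L X Y js) j v l = reachBits ones L X Y js v l)
    (hn : ones.testBit n = true) (i : Fin 2) :
    (slicedState L X Y n).Hits i ↔ (reachBits ones L X Y js (.inl 6) i).testBit n = true := by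
  refine ⟨fun h => testBit_of_reach hn ?_ hjs.1 hjs.2 h, reach_of_testBit_reachBits hn _ _ _⟩
  clear hjs
  induction js with
  | nil => simpa [reachBits] using hn
  | cons j js ih =>
    simp only [reachBits, cellStep]
    split_ifs
    · rw [Nat.testBit_or, ih]; rfl
    · exact ih

end

/-! ### Counting bits -/

/-- The number of ones among the lowest `2 ^ k` bits. -/
def bitCount (k x : ℕ) : ℕ := ((Finset.range (2 ^ k)).filter fun n => x.testBit n = true).card

theorem bitCount_succ (k x : ℕ) : bitCount (k + 1) x = bitCount k x + bitCount k (x >>> 2 ^ k) := by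
  simp only [bitCount, Finset.card_filter, pow_succ, mul_two, Finset.sum_range_add,
    Nat.testBit_shiftRight]

/-- A full adder acts on all bit positions at once: the first term is the sum bit, and the second
one is the carry. -/
theorem bitCount_full_adder (k x y c : ℕ) :
    bitCount k (x ^^^ y ^^^ c) + 2 * bitCount k ((x &&& y) ||| (c &&& (x ^^^ y))) =
      bitCount k x + bitCount k y + bitCount k c := by
  simp only [bitCount, Finset.card_filter, Finset.mul_sum, ← Finset.sum_add_distrib]
  refine Finset.sum_congr rfl fun n _ => ?_
  simp only [Nat.testBit_xor, Nat.testBit_and, Nat.testBit_or]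
  cases x.testBit n <;> cases y.testBit n <;> cases c.testBit n <;> rfl

/-- The number of ones in a list of binary numbers; the `i`-th one counts `2 ^ i` times. -/
def slicesCount (k : ℕ) : List ℕ → ℕ
  | [] => 0
  | x :: xs => bitCount k x + 2 * slicesCount k xs

/-- The sum, with carry `c`, of the numbers stored in two bit-sliced lists of equal length. -/
def addSlices : List ℕ → List ℕ → ℕ → List ℕ
  | x :: xs, y :: ys, c => (x ^^^ y ^^^ c) :: addSlices xs ys ((x &&& y) ||| (c &&& (x ^^^ y)))
  | _, _, c => [c]

theorem slicesCount_addSlices (k : ℕ) (xs ys : List ℕ) (h : xs.length = ys.length) (c : ℕ) :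
    slicesCount k (addSlices xs ys c) = slicesCount k xs + slicesCount k ys + bitCount k c := by
  induction xs generalizing ys c with
  | nil =>
    obtain rfl : ys = [] := List.length_eq_zero_iff.1 h.symm
    simp [addSlices, slicesCount]
  | cons x xs ih =>
    obtain ⟨y, ys, rfl⟩ := List.exists_cons_of_length_eq_add_one h.symm
    simp only [addSlices, slicesCount]
    rw [ih ys (by simpa using h)]
    have := bitCount_full_adder k x y c
    omega

/-- Each round adds the upper half of the positions to the lower half, so `2 ^ k` bits are counted
with `k` rounds of bitwise operations on large numbers, which the kernel evaluates quickly. The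
upper halves are not erased; they do no harm because `slicesCount k` looks only at the lowest `2 ^
k` positions. -/
def evalSlices : ℕ → List ℕ → ℕ
  | 0, xs => xs.foldr (fun x r => x % 2 + 2 * r) 0
  | k + 1, xs => evalSlices k (addSlices xs (xs.map fun x => x >>> 2 ^ k) 0)

theorem evalSlices_eq (k : ℕ) (xs : List ℕ) : evalSlices k xs = slicesCount k xs := by
  induction k generalizing xs with
  | zero =>
    simp only [evalSlices]
    induction xs with
    | nil => rfl
    | cons x xs ih =>
      have : bitCount 0 x = x % 2 := by
        rcases Nat.mod_two_eq_zero_or_one x with h | h <;>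
          simp [bitCount, Finset.filter_singleton, Nat.testBit_zero, h]
      rw [List.foldr_cons, ih, slicesCount, this]
  | succ k ih =>
    have h0 : bitCount k 0 = 0 := by simp [bitCount]
    rw [evalSlices, ih, slicesCount_addSlices _ _ _ (by simp), h0]
    induction xs with
    | nil => rfl
    | cons x xs ih =>
      simp only [List.map_cons, slicesCount, bitCount_succ] at ih ⊢
      omega

theorem bitCount_eq_evalSlices (k x : ℕ) : bitCount k x = evalSlices k [x] := by
  simp [evalSlices_eq, slicesCount]

/-- Bit `n` of `truthTable b k` is bit `b` of `n`, for `n < 2 ^ k`. -/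
def truthTable (b : ℕ) : ℕ → ℕ
  | 0 => 0
  | k + 1 => if k = b then (2 ^ 2 ^ b - 1) <<< 2 ^ b else
      truthTable b k ||| (truthTable b k <<< 2 ^ k)

theorem truthTable_lt (b k : ℕ) : truthTable b k < 2 ^ 2 ^ k := by
  induction k with
  | zero => simp [truthTable]
  | succ k ih =>
    rw [truthTable]
    split_ifs with h
    · subst h
      rw [pow_succ 2 k, mul_two]
      exact Nat.shiftLeft_lt (Nat.sub_lt (by positivity) one_pos)
    · rw [pow_succ 2 k, mul_two]
      exact Nat.or_lt_two_pow (ih.trans_le (Nat.pow_le_pow_right two_pos (Nat.le_add_left _ _)))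
        (Nat.shiftLeft_lt ih)

theorem testBit_truthTable (b k n : ℕ) (hb : b < k) (hn : n < 2 ^ k) :
    (truthTable b k).testBit n = n.testBit b := by
  induction k generalizing n with
  | zero => omega
  | succ k ih =>
    rw [truthTable]
    split_ifs with h
    · subst h
      rw [Nat.testBit_shiftLeft, Nat.testBit_two_pow_sub_one]
      rw [pow_succ] at hn
      by_cases h1 : n < 2 ^ k
      · simp [Nat.testBit_lt_two_pow h1, h1]
      · obtain ⟨m, rfl⟩ := Nat.exists_eq_add_of_le (not_lt.1 h1)
        rw [Nat.testBit_two_pow_add_eq, Nat.testBit_lt_two_pow (by omega)]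
        simp; omega
    · rw [Nat.testBit_or, Nat.testBit_shiftLeft]
      rw [pow_succ] at hn
      by_cases h1 : n < 2 ^ k
      · simp [ih n (by omega) h1, h1]
      · obtain ⟨m, rfl⟩ := Nat.exists_eq_add_of_le (not_lt.1 h1)
        rw [Nat.testBit_two_pow_add_gt (by omega), Nat.testBit_lt_two_pow
          ((truthTable_lt b k).trans_le (Nat.pow_le_pow_right two_pos (by omega)))]
        simp [ih m (by omega) (by omega)]

/-! ### Counting states of the chain -/

theorem not_cut_slicedState (L X Y : Fin 6 → ℕ) (n : ℕ) : ¬ (slicedState L X Y n).Cut := by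
  rintro (⟨q, hq⟩ | ⟨j, hj⟩)
  · simp [slicedState] at hq
  · revert hj
    simp only [slicedState, CellState.Balanced]
    cases (L j).testBit n <;> decide

theorem eq_slicedState {L X Y : Fin 6 → ℕ} {n : ℕ} {s : ChainState} (hs : ¬ s.Cut)
    (hL : ∀ j, (L j).testBit n = (s.1 j).1 1) (hX : ∀ j, (X j).testBit n = (s.1 j).2.1)
    (hY : ∀ j, (Y j).testBit n = (s.1 j).2.2) : slicedState L X Y n = s := by
  simp only [ChainState.Cut, not_or, not_exists] at hs
  refine Prod.ext (funext fun j => Prod.ext (funext fun l => ?_) (Prod.ext (hX j) (hY j)))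
    (funext fun q => by simpa [slicedState] using hs.1 q)
  have h2 := hs.2 j
  simp only [CellState.Balanced] at h2
  simp only [slicedState, hL]
  revert l
  rw [Fin.forall_fin_two]
  revert h2
  cases (s.1 j).1 0 <;> cases (s.1 j).1 1 <;> simp

/-- The hypotheses on `slicedState` say that the numbers below `2 ^ k` enumerate the relevant states
without repetition, so that the states hitting the target are the ones among the bits of a single
number. -/
theorem ncard_not_cut_hits {k : ℕ} {L X Y : Fin 6 → ℕ} {js : List (Fin 6)}
    (hjs : (∀ t, reachBits (2 ^ 2 ^ k - 1) L X Y js (.inr t) 0 =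
        reachBits (2 ^ 2 ^ k - 1) L X Y js (.inr t) 1) ∧
      ∀ j v l, cellStep (2 ^ 2 ^ k - 1) L X Y (reachBits (2 ^ 2 ^ k - 1) L X Y js) j v l =
        reachBits (2 ^ 2 ^ k - 1) L X Y js v l)
    (K : (Fin 6 → Bool × Bool) → (Fin 7 → Bool) → Prop)
    (hinj : Set.InjOn (slicedState L X Y) {n | n < 2 ^ k})
    (himg : slicedState L X Y '' {n | n < 2 ^ k} =
      {s : ChainState | K (fun j => (s.1 j).2) s.2 ∧ ¬ s.Cut}) (i : Fin 2) :
    {s : ChainState | K (fun j => (s.1 j).2) s.2 ∧ ¬ s.Cut ∧ s.Hits i}.ncard =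
      evalSlices k [reachBits (2 ^ 2 ^ k - 1) L X Y js (.inl 6) i] := by
  have h1 : {s : ChainState | K (fun j => (s.1 j).2) s.2 ∧ ¬ s.Cut ∧ s.Hits i} =
      slicedState L X Y '' {n | n < 2 ^ k ∧
        (reachBits (2 ^ 2 ^ k - 1) L X Y js (.inl 6) i).testBit n = true} := by
    ext s
    constructor
    · rintro ⟨hK, hc, hh⟩
      obtain ⟨n, hn, rfl⟩ : s ∈ slicedState L X Y '' {n | n < 2 ^ k} := himg ▸ ⟨hK, hc⟩
      refine ⟨n, ⟨hn, (hits_slicedState_iff hjs ?_ i).1 hh⟩, rfl⟩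
      simpa [Nat.testBit_two_pow_sub_one] using hn
    · rintro ⟨n, ⟨hn, hb⟩, rfl⟩
      have : slicedState L X Y n ∈ slicedState L X Y '' {n | n < 2 ^ k} := ⟨n, hn, rfl⟩
      rw [himg] at this
      refine ⟨this.1, this.2, (hits_slicedState_iff hjs ?_ i).2 hb⟩
      simpa [Nat.testBit_two_pow_sub_one] using hn
  rw [h1, (hinj.mono fun n hn => hn.1).ncard_image, ← bitCount_eq_evalSlices, bitCount,
    ← Set.ncard_coe_finset]
  congr 1
  ext n
  simp

/-! ### The finite counts -/

section

set_option maxRecDepth 100000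

/-- The cells in an order in which passing through them reaches every vertex that can be reached. -/
def sweep : List (Fin 6) := [0, 1, 2, 3, 4, 5, 4, 3, 2, 1, 0, 1, 2, 3, 4, 5, 4, 3, 2, 1, 0]

theorem ncard_hits_directed :
    {s : ChainState | s.Hits 0}.ncard + 4 ≤ {s : ChainState | s.Hits 1}.ncard := by
  have key : ∀ i, {s : ChainState | True ∧ ¬ s.Cut ∧ s.Hits i}.ncard = _ :=
    -- The bits `3 * j`, `3 * j + 1` and `3 * j + 2` of `n` encode the layer of the middle edge of
    -- the cell `j` and its two vertical edges.
    ncard_not_cut_hits (k := 18) (js := sweep) (L := fun j => truthTable (3 * j) 18)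
      (X := fun j => truthTable (3 * j + 1) 18) (Y := fun j => truthTable (3 * j + 2) 18)
      (by decide +kernel) (fun _ _ => True) ?_ ?_
  · have h := ncard_hits_le_of_not_cut (fun _ _ => True) 4 (by
      rw [key, key]; decide +kernel)
    simpa only [true_and] using h
  · intro n hn m hm h
    simp only [slicedState, Prod.mk.injEq, and_true, funext_iff, Set.mem_ofPred_eq] at h hn hm
    have h1 : ∀ j : Fin 6, n.testBit (3 * j) = m.testBit (3 * j) := fun j => by
      simpa [testBit_truthTable (3 * j) 18 _ (by omega) hn,
        testBit_truthTable (3 * j) 18 _ (by omega) hm] using (h j).1 1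
    have h2 : ∀ j : Fin 6, n.testBit (3 * j + 1) = m.testBit (3 * j + 1) := fun j => by
      simpa only [testBit_truthTable (3 * j + 1) 18 _ (by omega) hn,
        testBit_truthTable (3 * j + 1) 18 _ (by omega) hm] using (h j).2.1
    have h3 : ∀ j : Fin 6, n.testBit (3 * j + 2) = m.testBit (3 * j + 2) := fun j => by
      simpa only [testBit_truthTable (3 * j + 2) 18 _ (by omega) hn,
        testBit_truthTable (3 * j + 2) 18 _ (by omega) hm] using (h j).2.2
    refine Nat.eq_of_testBit_eq fun i => ?_
    by_cases hi : i < 18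
    · have : i = 3 * (i / 3) ∨ i = 3 * (i / 3) + 1 ∨ i = 3 * (i / 3) + 2 := by omega
      rcases this with h | h | h <;> rw [h]
      exacts [h1 ⟨i / 3, by omega⟩, h2 ⟨i / 3, by omega⟩, h3 ⟨i / 3, by omega⟩]
    · have : 2 ^ 18 ≤ 2 ^ i := Nat.pow_le_pow_right two_pos (by omega)
      rw [Nat.testBit_lt_two_pow (by omega), Nat.testBit_lt_two_pow (by omega)]
  · ext s
    constructor
    · rintro ⟨n, _, rfl⟩
      exact ⟨trivial, not_cut_slicedState _ _ _ _⟩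
    · rintro ⟨-, hs⟩
      let f : Fin 18 → Bool := fun i =>
        if i.1 % 3 = 0 then (s.1 ⟨i / 3, by omega⟩).1 1
        else if i.1 % 3 = 1 then (s.1 ⟨i / 3, by omega⟩).2.1 else (s.1 ⟨i / 3, by omega⟩).2.2
      have hlt := Nat.ofBits_lt_two_pow f
      refine ⟨Nat.ofBits f, hlt, eq_slicedState hs (fun j => ?_) (fun j => ?_) (fun j => ?_)⟩
      · rw [testBit_truthTable _ _ _ (by omega) hlt, Nat.testBit_ofBits_lt _ _ (by omega)]
        simp [f]
      · rw [testBit_truthTable _ _ _ (by omega) hlt, Nat.testBit_ofBits_lt _ _ (by omega)]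
        have h1 : (3 * j.1 + 1) % 3 = 1 := by omega
        have h2 : (3 * j.1 + 1) / 3 = j.1 := by omega
        simp [f, h1, h2]
      · rw [testBit_truthTable _ _ _ (by omega) hlt, Nat.testBit_ofBits_lt _ _ (by omega)]
        have h1 : (3 * j.1 + 2) % 3 = 2 := by omega
        have h2 : (3 * j.1 + 2) / 3 = j.1 := by omega
        simp [f, h1, h2]

theorem ncard_not_cut_hits_undirected :
    {s : ChainState | (∀ j, (s.1 j).2 = (false, false)) ∧ ¬ s.Cut ∧ s.Hits 0}.ncard + 1 ≤
      {s : ChainState | (∀ j, (s.1 j).2 = (false, false)) ∧ ¬ s.Cut ∧ s.Hits 1}.ncard := by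
  have key : ∀ i, {s : ChainState | (∀ j, (s.1 j).2 = (false, false)) ∧ ¬ s.Cut ∧
        s.Hits i}.ncard = _ :=
    ncard_not_cut_hits (k := 6) (js := sweep) (L := fun j => truthTable j 6)
      (X := fun _ => 0) (Y := fun _ => 0) (by decide +kernel)
      (fun xy _ => ∀ j, xy j = (false, false)) ?_ ?_
  · rw [key, key]; decide +kernel
  · intro n hn m hm h
    simp only [slicedState, Prod.mk.injEq, and_true, funext_iff, Set.mem_ofPred_eq] at h hn hm
    refine Nat.eq_of_testBit_eq fun i => ?_
    by_cases hi : i < 6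
    · simpa [testBit_truthTable i 6 _ hi hn, testBit_truthTable i 6 _ hi hm] using (h ⟨i, hi⟩).1 1
    · have : 2 ^ 6 ≤ 2 ^ i := Nat.pow_le_pow_right two_pos (by omega)
      rw [Nat.testBit_lt_two_pow (by omega), Nat.testBit_lt_two_pow (by omega)]
  · ext s
    constructor
    · rintro ⟨n, _, rfl⟩
      exact ⟨fun j => by simp [slicedState], not_cut_slicedState _ _ _ _⟩
    · rintro ⟨hxy, hs⟩
      have hlt := Nat.ofBits_lt_two_pow fun j => (s.1 j).1 1
      refine ⟨_, hlt, eq_slicedState hs (fun j => ?_) (fun j => ?_) (fun j => ?_)⟩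
      · rw [testBit_truthTable _ _ _ (by omega) hlt, Nat.testBit_ofBits_lt _ _ (by omega)]
      · simp [hxy j]
      · simp [hxy j]

end

theorem ncard_hits_undirected :
    {s : ChainState | (∀ j, (s.1 j).2 = (false, false)) ∧ s.Hits 0}.ncard + 1 ≤
      {s : ChainState | (∀ j, (s.1 j).2 = (false, false)) ∧ s.Hits 1}.ncard :=
  ncard_hits_le_of_not_cut (fun xy _ => ∀ j, xy j = (false, false)) 1 ncard_not_cut_hits_undirected

theorem ncard_hits_undirected_of_not_vert :
    {s : ChainState | ((∀ j, (s.1 j).2 = (false, false)) ∧ ∀ q, s.2 q = false) ∧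
        s.Hits 0}.ncard + 1 ≤
      {s : ChainState | ((∀ j, (s.1 j).2 = (false, false)) ∧ ∀ q, s.2 q = false) ∧
        s.Hits 1}.ncard := by
  refine ncard_hits_le_of_not_cut
    (fun xy vert => (∀ j, xy j = (false, false)) ∧ ∀ q, vert q = false) 1 ?_
  -- Uncut states have no vertical edges on the path anyway, so the additional condition changes
  -- only the cut states.
  have h : ∀ i, {s : ChainState | ((∀ j, (s.1 j).2 = (false, false)) ∧ ∀ q, s.2 q = false) ∧
        ¬ s.Cut ∧ s.Hits i} =
      {s : ChainState | (∀ j, (s.1 j).2 = (false, false)) ∧ ¬ s.Cut ∧ s.Hits i} := by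
    intro i; ext s
    simp only [Set.mem_ofPred_eq, ChainState.Cut, not_or, not_exists, Bool.not_eq_true]
    tauto
  rw [h, h]
  exact ncard_not_cut_hits_undirected

/-- The state in which precisely the middle edge in layer `c j` is retained in the cell `j`. -/
def layerState (c : Fin 6 → Fin 2) : ChainState :=
  (fun j => (fun l => l == c j, false, false), fun _ => false)

/-- The states `layerState c` are exactly the uncut states without vertical edges at entrances and
exits, so this is the count that decides the conditioned models. -/
theorem ncard_hits_layerState :
    {c | (layerState c).Hits 0}.ncard + 1 ≤ {c | (layerState c).Hits 1}.ncard := by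
  have hinj : Function.Injective layerState := by
    intro c d h
    simp only [layerState, Prod.mk.injEq, and_true, funext_iff] at h
    funext j
    simpa using h j (c j)
  have key : ∀ i, {c | (layerState c).Hits i}.ncard =
      {s : ChainState | (∀ j, (s.1 j).2 = (false, false)) ∧ ¬ s.Cut ∧ s.Hits i}.ncard := by
    intro i
    rw [← Set.ncard_image_of_injective _ hinj]
    congr 1
    ext s
    constructor
    · rintro ⟨c, hc, rfl⟩
      refine ⟨fun j => rfl, ?_, hc⟩
      rintro (⟨q, hq⟩ | ⟨j, hj⟩)
      · simp [layerState] at hq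
      · revert hj
        simp only [layerState, CellState.Balanced]
        generalize c j = d
        revert d; decide
    · rintro ⟨h1, h2, h3⟩
      have hs : layerState (fun j => if (s.1 j).1 0 = true then 0 else 1) = s := by
        simp only [ChainState.Cut, not_or, not_exists] at h2
        refine Prod.ext (funext fun j => Prod.ext (funext fun l => ?_) (h1 j).symm)
          (funext fun q => by simpa [layerState] using h2.1 q)
        have h4 := h2.2 j
        simp only [CellState.Balanced] at h4
        simp only [layerState]
        revert l
        rw [Fin.forall_fin_two]
        revert h4
        cases (s.1 j).1 0 <;> cases (s.1 j).1 1 <;> simp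
      exact ⟨_, by rwa [← hs] at h3, hs⟩
  rw [key, key]
  exact ncard_not_cut_hits_undirected

/-! ### Counting in a random set -/

theorem nat_card_set (α : Type) [Finite α] : Nat.card (Set α) = 2 ^ Nat.card α := by
  have := Fintype.ofFinite α
  rw [Nat.card_eq_fintype_card, Fintype.card_set, Nat.card_eq_fintype_card]

/-- The probability that a random set contains none of a family of disjoint blocks. -/
theorem ncard_forall_not_block_subset {E J : Type} [Finite E] [Fintype J] {w : J → ℕ}
    (blk : ∀ j, Fin (w j) → E)
    (hblk : Function.Injective fun p : Σ j, Fin (w j) => blk p.1 p.2) :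
    ({X : Set E | ∀ j, ∃ x, blk j x ∉ X}.ncard : ℚ) =
      2 ^ Nat.card E * ∏ j, (1 - (1 / 2) ^ w j) := by
  -- As the blocks are disjoint, a set is given by its traces on the blocks and on the rest `C`, all
  -- chosen independently.
  let C : Type := {e : E // ∀ j x, blk j x ≠ e}
  let enc : (∀ j, Set (Fin (w j))) × Set C → Set E := fun p =>
    {e | (∃ j x, blk j x = e ∧ x ∈ p.1 j) ∨ ∃ h, (⟨e, h⟩ : C) ∈ p.2}
  have hmem : ∀ p j x, blk j x ∈ enc p ↔ x ∈ p.1 j := by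
    intro p j x
    constructor
    · rintro (⟨j', x', h1, h2⟩ | ⟨h, -⟩)
      · have := @hblk ⟨j', x'⟩ ⟨j, x⟩ h1
        simp only [Sigma.mk.injEq] at this
        obtain ⟨rfl, h3⟩ := this
        rwa [← eq_of_heq h3]
      · exact absurd rfl (h j x)
    · exact fun h => Or.inl ⟨j, x, rfl, h⟩
  have hmem' : ∀ p (e : C), e.1 ∈ enc p ↔ e ∈ p.2 := by
    intro p e
    constructor
    · rintro (⟨j', x', h1, h2⟩ | ⟨h, h'⟩)
      · exact absurd h1 (e.2 _ _)
      · exact h'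
    · exact fun h => Or.inr ⟨e.2, h⟩
  have hinj : Function.Injective enc := by
    intro p q h
    refine Prod.ext (funext fun j => Set.ext fun x => ?_) (Set.ext fun e => ?_)
    · rw [← hmem, h, hmem]
    · rw [← hmem', h, hmem']
  have hsurj : Function.Surjective enc := by
    intro X
    refine ⟨(fun j => {x | blk j x ∈ X}, {e | e.1 ∈ X}), Set.ext fun e => ?_⟩
    by_cases he : ∀ j x, blk j x ≠ e
    · exact hmem' _ ⟨e, he⟩
    · push Not at he
      obtain ⟨j, x, rfl⟩ := he
      exact hmem _ j x
  have hE : 2 ^ Nat.card E = (∏ j, 2 ^ w j) * 2 ^ Nat.card C := by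
    rw [← nat_card_set, ← Nat.card_eq_of_bijective enc ⟨hinj, hsurj⟩, Nat.card_prod, Nat.card_pi,
      nat_card_set]
    simp
  let D : Type := (∀ j, {S : Set (Fin (w j)) // S ≠ Set.univ}) × Set C
  let enc' : D → Set E := fun p => enc (fun j => (p.1 j).1, p.2)
  have hinj' : Function.Injective enc' := by
    intro p q h
    have := hinj h
    simp only [Prod.mk.injEq, funext_iff] at this
    exact Prod.ext (funext fun j => Subtype.ext (this.1 j)) this.2
  have hrange : {X : Set E | ∀ j, ∃ x, blk j x ∉ X} = enc' '' Set.univ := by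
    ext X
    obtain ⟨p, rfl⟩ := hsurj X
    have : (∀ j, ∃ x, blk j x ∉ enc p) ↔ ∀ j, p.1 j ≠ Set.univ := by
      simp only [hmem, ne_eq, Set.eq_univ_iff_forall, not_forall]
    rw [Set.mem_ofPred_eq, this]
    constructor
    · exact fun h => ⟨(fun j => ⟨p.1 j, h j⟩, p.2), trivial, rfl⟩
    · rintro ⟨q, -, hq⟩ j
      rw [← hinj hq]
      exact (q.1 j).2
  have hsub : ∀ n : ℕ, (Nat.card {S : Set (Fin n) // S ≠ Set.univ} : ℚ) = 2 ^ n - 1 := by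
    intro n
    have h1 := Set.ncard_add_ncard_compl ({Set.univ} : Set (Set (Fin n)))
    rw [Set.ncard_singleton, nat_card_set, Nat.card_fin] at h1
    have h2 : Nat.card {S : Set (Fin n) // S ≠ Set.univ} = ({Set.univ}ᶜ : Set (Set (Fin n))).ncard :=
      rfl
    rw [h2, eq_sub_iff_add_eq']
    exact_mod_cast h1
  have hE' : (2 ^ Nat.card E : ℚ) = (∏ j, 2 ^ w j) * 2 ^ Nat.card C := by exact_mod_cast hE
  rw [hrange, Set.ncard_image_of_injective _ hinj', Set.ncard_univ, Nat.card_prod, Nat.card_pi,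
    nat_card_set, hE', mul_right_comm, ← Finset.prod_mul_distrib]
  push_cast
  simp only [hsub]
  congr 1
  refine Finset.prod_congr rfl fun j _ => ?_
  rw [mul_sub, mul_one, ← mul_pow]
  norm_num

/-- Comparison of the probabilities of two events, which are determined by the elements in the
image of `ic` as soon as, for each `b`, one of the blocks `blk b j` is contained in the random
set. -/
theorem ncard_lt_ncard_of_core {E I B J : Type} [Finite E] [Finite I] [Fintype B] [Fintype J]
    {ic : I → E} (hic : Function.Injective ic) {w : B → J → ℕ} (blk : ∀ b j, Fin (w b j) → E)
    (hblk : ∀ b, Function.Injective fun p : Σ j, Fin (w b j) => blk b p.1 p.2)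
    (hdisj : ∀ b j x i, blk b j x ≠ ic i) {P₀ P₁ : Set E → Prop} {c₀ c₁ : Set I → Prop}
    (h₀ : ∀ X, (∀ b, ∃ j, ∀ x, blk b j x ∈ X) → P₀ X → c₀ (ic ⁻¹' X))
    (h₁ : ∀ X, (∀ b, ∃ j, ∀ x, blk b j x ∈ X) → c₁ (ic ⁻¹' X) → P₁ X) {m : ℕ}
    (hm : {S | c₀ S}.ncard + m ≤ {S | c₁ S}.ncard)
    (hp : (∑ b, ∏ j, (1 - (1 / 2) ^ w b j : ℚ)) * (2 ^ Nat.card I + m) < m) :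
    {X | P₀ X}.ncard < {X | P₁ X}.ncard := by
  set good : Set E → Prop := fun X => ∀ b, ∃ j, ∀ x, blk b j x ∈ X with hgood
  set g := {Y : Set E | good Y ∧ ∀ i, ic i ∉ Y}.ncard with hg
  -- No block meets the core, so being good and the trace on the core are independent: each trace
  -- extends to exactly `g` good sets.
  have hsplit : ∀ c : Set I → Prop, {X | good X ∧ c (ic ⁻¹' X)}.ncard = {S | c S}.ncard * g := by
    intro c
    have hpre : ∀ (S : Set I) (Y : Set E), (∀ i, ic i ∉ Y) → ic ⁻¹' (ic '' S ∪ Y) = S := by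
      intro S Y hY
      ext i
      simp only [Set.mem_preimage, Set.mem_union, hY i, or_false, hic.mem_set_image]
    rw [hg, ← Set.ncard_prod, ← Set.InjOn.ncard_image (f := fun p : Set I × Set E => ic '' p.1 ∪ p.2)]
    · congr 1
      ext X
      constructor
      · rintro ⟨h1, h2⟩
        refine ⟨(ic ⁻¹' X, X \ Set.range ic), ⟨h2, fun b => ?_, fun i hi => hi.2 ⟨i, rfl⟩⟩, ?_⟩
        · obtain ⟨j, hj⟩ := h1 b
          exact ⟨j, fun x => ⟨hj x, fun ⟨i, hi⟩ => hdisj b j x i hi.symm⟩⟩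
        · simp only [Set.image_preimage_eq_inter_range]
          exact Set.inter_union_sdiff X _
      · rintro ⟨⟨S, Y⟩, ⟨h1, h2, h3⟩, rfl⟩
        refine ⟨fun b => ?_, ?_⟩
        · obtain ⟨j, hj⟩ := h2 b
          exact ⟨j, fun x => Or.inr (hj x)⟩
        · simp only
          rwa [hpre S Y h3]
    · rintro ⟨S, Y⟩ ⟨-, -, h3⟩ ⟨S', Y'⟩ ⟨-, -, h3'⟩ h
      simp only at h h3 h3'
      have hS : S = S' := by rw [← hpre S Y h3, h, hpre S' Y' h3']
      have hdiff : ∀ (S : Set I) (Y : Set E), (∀ i, ic i ∉ Y) →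
          (ic '' S ∪ Y) \ Set.range ic = Y := by
        intro S Y hY
        ext e
        constructor
        · rintro ⟨⟨i, -, rfl⟩ | he, h⟩
          · exact absurd ⟨i, rfl⟩ h
          · exact he
        · exact fun he => ⟨Or.inr he, fun ⟨i, hi⟩ => hY i (hi ▸ he)⟩
      have hY : Y = Y' := by rw [← hdiff S Y h3, h, hdiff S' Y' h3']
      rw [hS, hY]
  have hG : {X | good X}.ncard = 2 ^ Nat.card I * g := by
    have := hsplit fun _ => True
    simp only [and_true] at this
    rw [this, ← nat_card_set, ← Set.ncard_univ]
    rfl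
  have hcompl : {X | good X}.ncard + {X | ¬ good X}.ncard = 2 ^ Nat.card E := by
    rw [← nat_card_set]
    exact Set.ncard_add_ncard_compl _
  -- Union bound over `b`; for a fixed `b`, the blocks fail independently.
  have hbad : ({X | ¬ good X}.ncard : ℚ) ≤
      2 ^ Nat.card E * ∑ b, ∏ j, (1 - (1 / 2) ^ w b j : ℚ) := by
    have h1 : {X | ¬ good X} = ⋃ b, {X : Set E | ∀ j, ∃ x, blk b j x ∉ X} := by
      ext X; simp [hgood]
    rw [h1, Finset.mul_sum]
    refine (Nat.cast_le.2 (Set.ncard_iUnion_le_of_fintype _)).trans ?_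
    rw [Nat.cast_sum]
    exact Finset.sum_le_sum fun b _ => (ncard_forall_not_block_subset (blk b) (hblk b)).le
  have hlow : {S | c₁ S}.ncard * g ≤ {X | P₁ X}.ncard := by
    rw [← hsplit]
    exact Set.ncard_le_ncard (fun X hX => h₁ X hX.1 hX.2) (Set.toFinite _)
  have hupp : {X | P₀ X}.ncard ≤ {S | c₀ S}.ncard * g + {X | ¬ good X}.ncard := by
    rw [← hsplit]
    refine (Set.ncard_le_ncard (fun X hX => ?_) (Set.toFinite _)).trans (Set.ncard_union_le _ _)
    by_cases h : good X
    · exact Or.inl ⟨h, h₀ X h hX⟩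
    · exact Or.inr h
  -- In the worst case all bad sets count in favour of `P₀`, whereas the core gives `P₁` an
  -- advantage of `m * g`. Since there are `2 ^ Nat.card I * g` good sets, the bound on the bad
  -- fraction in `hp` is what makes this advantage larger.
  have hlt : {X | ¬ good X}.ncard < m * g := by
    set bad := {X | ¬ good X}.ncard
    set p := ∑ b, ∏ j, (1 - (1 / 2) ^ w b j : ℚ)
    have h1 : (2 ^ Nat.card I * g + bad : ℚ) = 2 ^ Nat.card E := by
      rw [hG] at hcompl; exact_mod_cast hcompl
    have h2 : (0 : ℚ) < 2 ^ Nat.card E := by positivity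
    have h3 : (0 : ℚ) < 2 ^ Nat.card I := by positivity
    have h4 : (bad : ℚ) * (2 ^ Nat.card I + m) < m * (2 ^ Nat.card I * g + bad) := by
      rw [h1]
      calc (bad : ℚ) * (2 ^ Nat.card I + m)
          ≤ 2 ^ Nat.card E * p * (2 ^ Nat.card I + m) := by gcongr
        _ = 2 ^ Nat.card E * (p * (2 ^ Nat.card I + m)) := by ring
        _ < 2 ^ Nat.card E * m := by gcongr
        _ = m * 2 ^ Nat.card E := by ring
    have h5 : (2 : ℚ) ^ Nat.card I * bad < 2 ^ Nat.card I * (m * g) := by linarith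
    exact_mod_cast lt_of_mul_lt_mul_left h5 h3.le
  have := Nat.mul_le_mul_right g hm
  rw [add_mul] at this
  omega

/-! ### From counts to probabilities -/

theorem Model.prob_lt_prob {V : Type} {N : Net V} (M : Model N) [Finite M.Outcome] {x y z : V}
    (h : {ω ∈ M.outcomes | Conn N (M.retained ω) x y}.ncard <
      {ω ∈ M.outcomes | Conn N (M.retained ω) x z}.ncard) : M.prob x y < M.prob x z := by
  have h0 : 0 < M.outcomes.ncard := (Nat.zero_le _).trans_lt
    (h.trans_le (Set.ncard_le_ncard (Set.sep_subset _ _) (Set.toFinite _)))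
  unfold Model.prob
  gcongr

theorem Model.prob_lt_prob_of_univ {V : Type} {N : Net V} (M : Model N) [Finite M.Outcome]
    (hM : M.outcomes = Set.univ) {x y z : V}
    (h : {ω | Conn N (M.retained ω) x y}.ncard < {ω | Conn N (M.retained ω) x z}.ncard) :
    M.prob x y < M.prob x z :=
  M.prob_lt_prob (by simpa only [hM, Set.mem_univ, true_and] using h)

/-- The comparison of probabilities in a model with one choice of a layer for each cell. -/
theorem Model.prob_lt_prob_of_layerState {V : Type} {N : Net V} (M : Model N) [Finite M.Outcome]
    {x : V} {y : Fin 2 → V} {enc : (Fin 6 → Fin 2) → M.Outcome} (hinj : Function.Injective enc)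
    (hrange : M.outcomes = Set.range enc)
    (h : ∀ c i, Conn N (M.retained (enc c)) x (y i) ↔ (layerState c).Hits i) :
    M.prob x (y 0) < M.prob x (y 1) := by
  have key : ∀ i, {ω ∈ M.outcomes | Conn N (M.retained ω) x (y i)} =
      enc '' {c | (layerState c).Hits i} := by
    intro i; ext ω
    rw [hrange]
    constructor
    · rintro ⟨⟨c, rfl⟩, hc⟩
      exact ⟨c, (h c i).1 hc, rfl⟩
    · rintro ⟨c, hc, rfl⟩
      exact ⟨⟨c, rfl⟩, (h c i).2 hc⟩
  apply M.prob_lt_prob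
  rw [key, key, Set.ncard_image_of_injective _ hinj, Set.ncard_image_of_injective _ hinj]
  exact ncard_hits_layerState

theorem not_bunkbedConjecture {V : Type} {Q : Net V} {M : Model (bunkbed Q)} {u v : V}
    (h : M.prob (u, 0) (v, 0) < M.prob (u, 0) (v, 1)) : ¬ BunkbedConjecture M :=
  fun hM => (hM u v).not_gt h

/-! ### The hypergraph `H4` as a chain of cells -/

/-- The vertex of `H4` corresponding to a vertex of the chain. -/
def chainToH4 : ChainVertex → Fin 10 := Sum.elim ![0, 2, 3, 4, 5, 7, 9] ![1, 8, 6]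

theorem chainToH4_injective : Function.Injective chainToH4 := by
  unfold Function.Injective; decide

theorem chainToH4_surjective : Function.Surjective chainToH4 := by
  unfold Function.Surjective; decide

theorem chainToH4_mem_T4 {v : ChainVertex} : chainToH4 v ∈ T4 ↔ ∃ t, v = .inr t := by
  simp only [T4, Set.mem_insert_iff, Set.mem_singleton_iff]
  revert v; decide

/-- The hyperedge of `H4` corresponding to a cell. -/
def cellSet (j : Fin 6) : Set (Fin 10) :=
  {chainToH4 (.inl j.castSucc), chainToH4 (.inl j.succ), chainToH4 (.inr (cellPost j))}

theorem chainToH4_mem_cellSet {j : Fin 6} {v : ChainVertex} :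
    chainToH4 v ∈ cellSet j ↔ ChainMem j v := by
  simp only [cellSet, Set.mem_insert_iff, Set.mem_singleton_iff, ChainMem,
    chainToH4_injective.eq_iff]

theorem H4_edgeSet : H4.edgeSet = Set.range cellSet := by
  have h : cellSet = ![{0, 2, 1}, {2, 3, 8}, {3, 4, 6}, {4, 5, 1}, {5, 7, 6}, {7, 9, 8}] := by
    funext j; fin_cases j <;> rfl
  have h' : ({0, 2, 1} : Set (Fin 10)) = {0, 1, 2} := by rw [Set.pair_comm]
  rw [h, h']
  ext e
  simp [H4]
  tauto

theorem cellSet_injective : Function.Injective cellSet := by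
  intro i j h
  have h1 : ∀ v, ChainMem i v ↔ ChainMem j v := fun v => by
    rw [← chainToH4_mem_cellSet, h, chainToH4_mem_cellSet]
  revert h1; clear h; revert i j; decide

def cellEdge (j : Fin 6) : H4.edgeSet := ⟨cellSet j, by rw [H4_edgeSet]; exact ⟨j, rfl⟩⟩

theorem cellEdge_injective : Function.Injective cellEdge := fun _ _ h =>
  cellSet_injective (congrArg Subtype.val h)

theorem cellEdge_surjective : Function.Surjective cellEdge := by
  rintro ⟨f, hf⟩
  obtain ⟨j, rfl⟩ : f ∈ Set.range cellSet := H4_edgeSet ▸ hf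
  exact ⟨j, rfl⟩

/-- A relation `R` simulates a relation `S` on the image of `ι` if every step of `S` is a path of
`R`, and if elements with a shadow in the domain of `S` are only joined in agreement with `S`. -/
theorem reflTransGen_iff_of_shadow {W C : Type} {R : W → W → Prop} {S : C → C → Prop} (ι : C → W)
    (sh : W → C → Prop) (h₁ : ∀ p q, S p q → Relation.ReflTransGen R (ι p) (ι q))
    (h₂ : ∀ w w' p, R w w' → sh w p → ∃ p', Relation.ReflTransGen S p p' ∧ sh w' p')
    (h₃ : ∀ p, sh (ι p) p) (h₄ : ∀ p q, sh (ι q) p → Relation.ReflTransGen S p q) (a b : C) :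
    Relation.ReflTransGen R (ι a) (ι b) ↔ Relation.ReflTransGen S a b := by
  constructor
  · intro h
    have : ∀ w, Relation.ReflTransGen R (ι a) w → ∃ p, Relation.ReflTransGen S a p ∧ sh w p := by
      intro w hw
      induction hw with
      | refl => exact ⟨a, .refl, h₃ a⟩
      | tail _ hs ih =>
        obtain ⟨p, hp, hp'⟩ := ih
        obtain ⟨q, hq, hq'⟩ := h₂ _ _ _ hs hp'
        exact ⟨q, hp.trans hq, hq'⟩
    obtain ⟨p, hp, hp'⟩ := this _ h
    exact hp.trans (h₄ _ _ hp')
  · intro h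
    induction h with
    | refl => exact .refl
    | tail _ hs ih => exact ih.trans (h₁ _ _ hs)

theorem ChainState.Vert.step {s : ChainState} {v : ChainVertex} (h : s.Vert v) (l m : Fin 2) :
    s.Step (v, l) (v, m) := Or.inr ⟨rfl, h⟩

theorem ChainState.cell_step {s : ChainState} {j : Fin 6} {v w : ChainVertex} {l m : Fin 2}
    (hv : ChainMem j v) (hw : ChainMem j w) (h : (s.1 j).Passes l m) : s.Step (v, l) (w, m) :=
  Or.inl ⟨j, hv, hw, h⟩

/-! ### One choice of a layer for each cell -/

section

variable {E V : Type}

/-- Both copies of the elements of `F`, and the copy of `mid j` in layer `c j` for each `j`. -/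
def layerSet (F : Set E) (mid : Fin 6 → E) (c : Fin 6 → Fin 2) : Set (E × Fin 2) :=
  {p | p.1 ∈ F ∨ ∃ j, p.1 = mid j ∧ p.2 = c j}

theorem mem_layerSet {F : Set E} {mid : Fin 6 → E} {c : Fin 6 → Fin 2}
    (hmid : Function.Injective mid) (hF : ∀ j, mid j ∉ F) {j : Fin 6} {l : Fin 2} :
    (mid j, l) ∈ layerSet F mid c ↔ l = c j := by
  constructor
  · rintro (h | ⟨i, h, h'⟩)
    · exact absurd h (hF j)
    · rw [hmid h]; exact h'
  · exact fun h => Or.inr ⟨j, rfl, h⟩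

theorem layerSet_injective {F : Set E} {mid : Fin 6 → E} (hmid : Function.Injective mid)
    (hF : ∀ j, mid j ∉ F) : Function.Injective (layerSet F mid) := by
  intro c d h
  funext j
  rw [← mem_layerSet hmid hF, ← h, mem_layerSet hmid hF]

theorem range_layerSet {F : Set E} {mid : Fin 6 → E} (hmid : Function.Injective mid)
    (hF : ∀ e, e ∉ F ↔ ∃ j, e = mid j) :
    {Y : Set (E × Fin 2) | ∀ e, (e ∈ F → (e, 0) ∈ Y ∧ (e, 1) ∈ Y) ∧
      (e ∉ F → Xor ((e, 0) ∈ Y) ((e, 1) ∈ Y))} = Set.range (layerSet F mid) := by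
  have hF' : ∀ j, mid j ∉ F := fun j => (hF _).2 ⟨j, rfl⟩
  ext Y
  constructor
  · intro h
    classical
    refine ⟨fun j => if (mid j, 0) ∈ Y then 0 else 1, ?_⟩
    ext ⟨e, l⟩
    have hl : l = 0 ∨ l = 1 := by omega
    by_cases he : e ∈ F
    · have h3 := (h e).1 he
      exact iff_of_true (Or.inl he) (by rcases hl with rfl | rfl; exacts [h3.1, h3.2])
    · have h3 := (h e).2 he
      obtain ⟨j, rfl⟩ := (hF e).1 he
      rw [mem_layerSet hmid hF']
      rcases h3 with ⟨h3, h5⟩ | ⟨h3, h5⟩ <;> rcases hl with rfl | rfl <;> simp [h3, h5]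
  · rintro ⟨c, rfl⟩ e
    refine ⟨fun he => ⟨Or.inl he, Or.inl he⟩, fun he => ?_⟩
    obtain ⟨j, rfl⟩ := (hF e).1 he
    rw [mem_layerSet hmid hF', mem_layerSet hmid hF']
    generalize c j = d
    revert d
    simp [Fin.forall_fin_two, xor_def]

/-- The set of edges of a bunkbed structure with prescribed horizontal and vertical edges. -/
def bondSet (Y : Set (E × Fin 2)) (T : Set V) : Set ((E × Fin 2) ⊕ V) :=
  {e | Sum.elim (· ∈ Y) (· ∈ T) e}

theorem bondSet_injective (T : Set V) :
    Function.Injective fun Y : Set (E × Fin 2) => bondSet Y T := by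
  intro Y Z h
  ext p
  exact (Set.ext_iff.1 h (.inl p) :)

theorem range_bondSet {ι : Type} {𝒴 : Set (Set (E × Fin 2))} {f : ι → Set (E × Fin 2)} (T : Set V)
    (h : 𝒴 = Set.range f) :
    {X : Set ((E × Fin 2) ⊕ V) | Sum.inl ⁻¹' X ∈ 𝒴 ∧ ∀ v, Sum.inr v ∈ X ↔ v ∈ T} =
      Set.range fun i => bondSet (f i) T := by
  rw [h]
  ext X
  constructor
  · rintro ⟨⟨i, hi⟩, hT⟩
    refine ⟨i, Set.ext ?_⟩
    rintro (p | v)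
    · exact Set.ext_iff.1 hi p
    · exact (hT v).symm
  · rintro ⟨i, rfl⟩
    exact ⟨⟨i, rfl⟩, fun v => Iff.rfl⟩

end

/-! ### The digraph `D6` -/

/-- The steps in the bunkbed structure over `D6` for a given state of the chain. -/
inductive DigraphStep (s : ChainState) : D6Vertex × Fin 2 → D6Vertex × Fin 2 → Prop
  | enter (v j l) : ChainMem j v → DigraphStep s (.old (chainToH4 v), l) (.x (cellEdge j), l)
  | middle (j l) : (s.1 j).1 l = true → DigraphStep s (.x (cellEdge j), l) (.y (cellEdge j), l)
  | leave (v j l) : ChainMem j v → DigraphStep s (.y (cellEdge j), l) (.old (chainToH4 v), l)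
  | vertEnter (j l m) : l ≠ m → (s.1 j).2.1 = true →
      DigraphStep s (.x (cellEdge j), l) (.x (cellEdge j), m)
  | vertExit (j l m) : l ≠ m → (s.1 j).2.2 = true →
      DigraphStep s (.y (cellEdge j), l) (.y (cellEdge j), m)
  | vert (v l m) : l ≠ m → s.Vert v →
      DigraphStep s (.old (chainToH4 v), l) (.old (chainToH4 v), m)

/-- The vertices from which one gets to a vertex over `D6` without leaving a cell. -/
def DigraphShadow (s : ChainState) (w : D6Vertex × Fin 2) (p : ChainVertex × Fin 2) : Prop :=
  match w.1 with
  | .old u => chainToH4 p.1 = u ∧ p.2 = w.2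
  | .x f => ∃ j, f = cellEdge j ∧ ChainMem j p.1 ∧ (p.2 = w.2 ∨ (s.1 j).2.1 = true)
  | .y f => ∃ j, f = cellEdge j ∧ ChainMem j p.1 ∧ (s.1 j).Passes p.2 w.2

/-- Crossing a cell means entering at `x_f`, possibly changing the layer there, using a middle edge,
possibly changing the layer at `y_f`, and leaving. The direction of the edges forces this order, so
a walk inside a cell has no effect until it leaves, and the shadow remembers from where it can be
seen as a single crossing. -/
theorem digraphStep_reflTransGen_iff (s : ChainState) (p q : ChainVertex × Fin 2) :
    Relation.ReflTransGen (DigraphStep s) (.old (chainToH4 p.1), p.2) (.old (chainToH4 q.1), q.2) ↔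
      s.Reach p q := by
  refine reflTransGen_iff_of_shadow
    (fun p : ChainVertex × Fin 2 => (D6Vertex.old (chainToH4 p.1), p.2)) (DigraphShadow s)
    ?_ ?_ (fun p => ⟨rfl, rfl⟩) ?_ p q
  · rintro ⟨v, l⟩ ⟨w, m⟩ (⟨j, hv, hw, k, h1, h2, h3⟩ | ⟨h1, h2⟩)
    · have hx : Relation.ReflTransGen (DigraphStep s) (.x (cellEdge j), l) (.x (cellEdge j), k) := by
        by_cases hlk : l = k
        · rw [hlk]
        · exact .single (.vertEnter _ _ _ hlk (h1.resolve_left hlk))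
      have hy : Relation.ReflTransGen (DigraphStep s) (.y (cellEdge j), k) (.y (cellEdge j), m) := by
        by_cases hkm : k = m
        · rw [hkm]
        · exact .single (.vertExit _ _ _ hkm (h3.resolve_left hkm))
      exact ((((Relation.ReflTransGen.single (.enter v j l hv)).trans hx).tail
        (.middle j k h2)).trans hy).tail (.leave w j m hw)
    · simp only at h1 h2
      subst h1
      by_cases hlm : l = m
      · rw [hlm]
      · exact .single (.vert _ _ _ hlm h2)
  · rintro w w' ⟨v, l'⟩ hs hsh
    cases hs with
    | enter v' j l hv =>
      obtain ⟨h1, h2⟩ := hsh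
      obtain rfl := chainToH4_injective h1
      exact ⟨_, .refl, j, rfl, hv, Or.inl h2⟩
    | middle j l h =>
      obtain ⟨j', h1, h2, h3⟩ := hsh
      obtain rfl := cellEdge_injective h1
      exact ⟨_, .refl, j, rfl, h2, l, h3, h, Or.inl rfl⟩
    | leave v' j l hv =>
      obtain ⟨j', h1, h2, h3⟩ := hsh
      obtain rfl := cellEdge_injective h1
      exact ⟨(v', l), .single (ChainState.cell_step h2 hv h3), rfl, rfl⟩
    | vertEnter j l m hlm h =>
      obtain ⟨j', h1, h2, h3⟩ := hsh
      obtain rfl := cellEdge_injective h1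
      exact ⟨_, .refl, j, rfl, h2, Or.inr h⟩
    | vertExit j l m hlm h =>
      obtain ⟨j', h1, h2, k, h3, h4, h5⟩ := hsh
      obtain rfl := cellEdge_injective h1
      exact ⟨_, .refl, j, rfl, h2, k, h3, h4, Or.inr h⟩
    | vert v' l m hlm h =>
      obtain ⟨h1, h2⟩ := hsh
      obtain rfl := chainToH4_injective h1
      exact ⟨(v, m), .single (h.step _ _), rfl, rfl⟩
  · rintro ⟨v, l⟩ ⟨w, m⟩ ⟨h1, h2⟩
    obtain rfl := chainToH4_injective h1
    obtain rfl : l = m := h2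
    exact .refl

def middleEdge (j : Fin 6) : DEdge D6 := ⟨(.x (cellEdge j), .y (cellEdge j)), .middle _⟩

theorem middleEdge_injective : Function.Injective middleEdge := by
  intro i j h
  exact cellEdge_injective (D6Vertex.x.inj (congrArg (fun e : DEdge D6 => e.1.1) h))

theorem middleEdge_notMem_F6 (j : Fin 6) : middleEdge j ∉ F6 := fun h => h (cellEdge j) rfl

theorem exists_eq_middleEdge {e : DEdge D6} (h : e ∉ F6) : ∃ j, e = middleEdge j := by
  simp only [F6, Set.mem_ofPred_eq, not_forall, not_not] at h
  obtain ⟨f, hf⟩ := h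
  obtain ⟨j, rfl⟩ := cellEdge_surjective f
  exact ⟨j, Subtype.ext hf⟩

def enterEdge (v : ChainVertex) (j : Fin 6) (h : ChainMem j v) : DEdge D6 :=
  ⟨(.old (chainToH4 v), .x (cellEdge j)), .enter _ _ (chainToH4_mem_cellSet.2 h)⟩

def leaveEdge (v : ChainVertex) (j : Fin 6) (h : ChainMem j v) : DEdge D6 :=
  ⟨(.y (cellEdge j), .old (chainToH4 v)), .leave _ _ (chainToH4_mem_cellSet.2 h)⟩

theorem enterEdge_mem_F6 (v : ChainVertex) (j : Fin 6) (h : ChainMem j v) :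
    enterEdge v j h ∈ F6 := fun _ hf => D6Vertex.noConfusion (congrArg Prod.fst hf)

theorem leaveEdge_mem_F6 (v : ChainVertex) (j : Fin 6) (h : ChainMem j v) :
    leaveEdge v j h ∈ F6 := fun _ hf => D6Vertex.noConfusion (congrArg Prod.fst hf)

theorem old_mem_T6 {v : ChainVertex} : D6Vertex.old (chainToH4 v) ∈ T6 ↔ ∃ t, v = .inr t := by
  rw [← chainToH4_mem_T4, T6]
  simp

/-- The retained edges over `D6` if the middle edge of the cell `j` is retained in layer `c j`. -/
def digraphOutcome (c : Fin 6 → Fin 2) : Set (BEdge (ofDigraph D6)) :=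
  bondSet (layerSet F6 middleEdge c) T6

theorem E6_outcomes : (E6 D6 T6 F6).outcomes = Set.range digraphOutcome :=
  range_bondSet T6 (range_layerSet middleEdge_injective
    (fun _ => ⟨exists_eq_middleEdge, fun ⟨j, hj⟩ => hj ▸ middleEdge_notMem_F6 j⟩))

theorem digraphOutcome_injective : Function.Injective digraphOutcome :=
  (bondSet_injective T6).comp (layerSet_injective middleEdge_injective middleEdge_notMem_F6)

theorem conn_digraphOutcome_iff (c : Fin 6 → Fin 2) (p q : D6Vertex × Fin 2) :
    Conn (bunkbed (ofDigraph D6)) (digraphOutcome c) p q ↔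
      Relation.ReflTransGen (DigraphStep (layerState c)) p q := by
  unfold Conn
  constructor <;> refine Relation.ReflTransGen.mono ?_ _ _
  · rintro ⟨a, l⟩ ⟨b, m⟩ ⟨⟨e, i⟩ | v, he, hj⟩
    · obtain ⟨rfl, h2, h3⟩ : l = i ∧ m = i ∧ e.1 = (a, b) := hj
      subst h2
      obtain ⟨⟨a', b'⟩, hab⟩ := e
      obtain ⟨rfl, rfl⟩ := Prod.mk.injEq .. ▸ h3
      cases hab with
      | enter u f hu =>
        obtain ⟨j, rfl⟩ := cellEdge_surjective f
        obtain ⟨v, rfl⟩ := chainToH4_surjective u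
        exact .enter _ _ _ (chainToH4_mem_cellSet.1 hu)
      | middle f =>
        rcases he with he | ⟨j, h1, h2⟩
        · exact absurd rfl (he f)
        · obtain rfl := D6Vertex.x.inj (congrArg (fun e : DEdge D6 => e.1.1) h1)
          exact .middle _ _ (by simpa [layerState] using h2)
      | leave u f hu =>
        obtain ⟨j, rfl⟩ := cellEdge_surjective f
        obtain ⟨v, rfl⟩ := chainToH4_surjective u
        exact .leave _ _ _ (chainToH4_mem_cellSet.1 hu)
    · obtain ⟨rfl, rfl, hlm⟩ : a = v ∧ b = v ∧ l ≠ m := hj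
      obtain ⟨u, hu, rfl⟩ : b ∈ T6 := he
      obtain ⟨v, rfl⟩ := chainToH4_surjective u
      obtain ⟨t, rfl⟩ := chainToH4_mem_T4.1 hu
      exact .vert _ _ _ hlm trivial
  · rintro _ _ hs
    cases hs with
    | enter v j l hv =>
      exact ⟨.inl (enterEdge v j hv, l), Or.inl (enterEdge_mem_F6 _ _ hv),
        rfl, rfl, rfl⟩
    | middle j l h =>
      exact ⟨.inl (middleEdge j, l), Or.inr ⟨j, rfl, by simpa [layerState] using h⟩, rfl, rfl, rfl⟩
    | leave v j l hv =>
      exact ⟨.inl (leaveEdge v j hv, l), Or.inl (leaveEdge_mem_F6 _ _ hv),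
        rfl, rfl, rfl⟩
    | vertEnter j l m hlm h => simp [layerState] at h
    | vertExit j l m hlm h => simp [layerState] at h
    | vert v l m hlm h =>
      rcases v with q | t
      · simp [ChainState.Vert, layerState] at h
      · exact ⟨.inr (.old (chainToH4 (.inr t))), old_mem_T6.2 ⟨t, rfl⟩, rfl, rfl, hlm⟩

instance : Finite D6Vertex :=
  Finite.of_injective (β := Fin 10 ⊕ H4.edgeSet ⊕ H4.edgeSet)
    (fun | .old u => .inl u | .x f => .inr (.inl f) | .y f => .inr (.inr f))
    (by rintro (_ | _ | _) (_ | _ | _) h <;> simp_all)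

theorem nat_card_D6Vertex : Nat.card D6Vertex = 22 := by
  have e : D6Vertex ≃ Fin 10 ⊕ H4.edgeSet ⊕ H4.edgeSet :=
    { toFun := fun | .old u => .inl u | .x f => .inr (.inl f) | .y f => .inr (.inr f)
      invFun := fun | .inl u => .old u | .inr (.inl f) => .x f | .inr (.inr f) => .y f
      left_inv := by rintro (_ | _ | _) <;> rfl
      right_inv := by rintro (_ | _ | _) <;> rfl }
  have h6 : Nat.card H4.edgeSet = 6 := by
    rw [← Nat.card_eq_of_bijective cellEdge ⟨cellEdge_injective, cellEdge_surjective⟩, Nat.card_fin]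
  have : Finite H4.edgeSet := Set.toFinite _
  rw [Nat.card_congr e, Nat.card_sum, Nat.card_sum, h6, Nat.card_fin]

theorem E6_prob_lt : (E6 D6 T6 F6).prob (.old 0, 0) (.old 9, 0) <
    (E6 D6 T6 F6).prob (.old 0, 0) (.old 9, 1) := by
  have : Finite (E6 D6 T6 F6).Outcome :=
    inferInstanceAs (Finite (Set ((DEdge D6 × Fin 2) ⊕ D6Vertex)))
  refine (E6 D6 T6 F6).prob_lt_prob_of_layerState (y := fun i => (.old 9, i))
    digraphOutcome_injective E6_outcomes fun c i => ?_
  exact (conn_digraphOutcome_iff _ _ _).trans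
    (digraphStep_reflTransGen_iff _ (.inl 0, 0) (.inl 6, i))

/-! ### The multidigraph `D7` -/

abbrev D7BunkbedEdge : Type := (GadgetEdge D6 T6 F6 690 × Fin 2) ⊕ GadgetVertex T6 690

/-- The edges over `D7` that determine the state of the chain: the middle edges, and the vertical
edges at vertices outside `T6`. -/
abbrev DigraphCore : Type := (Fin 6 × Fin 2) ⊕ Fin 7 ⊕ Fin 6 ⊕ Fin 6

def digraphCoreEdge : DigraphCore → D7BunkbedEdge
  | .inl (j, l) => .inl (.inl (.inl ⟨middleEdge j, middleEdge_notMem_F6 j⟩), l)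
  | .inr (.inl q) => .inr (.inl (.old (chainToH4 (.inl q))))
  | .inr (.inr (.inl j)) => .inr (.inl (.x (cellEdge j)))
  | .inr (.inr (.inr j)) => .inr (.inl (.y (cellEdge j)))

theorem digraphCoreEdge_injective : Function.Injective digraphCoreEdge := by
  rintro (⟨i, l⟩ | q | i | i) (⟨j, m⟩ | r | j | j) h <;>
    simp [digraphCoreEdge, middleEdge_injective.eq_iff, chainToH4_injective.eq_iff,
      cellEdge_injective.eq_iff] at h ⊢
  all_goals exact h

open Classical in
noncomputable def digraphCoreState (S : Set DigraphCore) : ChainState :=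
  (fun j => (fun l => decide (.inl (j, l) ∈ S), decide (.inr (.inr (.inl j)) ∈ S),
    decide (.inr (.inr (.inr j)) ∈ S)), fun q => decide (.inr (.inl q) ∈ S))

/-- Vertical edges at all `x_f` and `y_f` are random here, so the core realizes every state of the
chain exactly once. -/
theorem digraphCoreState_bijective : Function.Bijective digraphCoreState := by
  constructor
  · intro S S' h
    simp only [digraphCoreState, Prod.mk.injEq, funext_iff, decide_eq_decide] at h
    ext i
    rcases i with ⟨j, l⟩ | q | j | j
    exacts [(h.1 j).1 l, h.2 q, (h.1 j).2.1, (h.1 j).2.2]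
  · intro s
    refine ⟨{i | match i with
      | .inl (j, l) => (s.1 j).1 l = true
      | .inr (.inl q) => s.2 q = true
      | .inr (.inr (.inl j)) => (s.1 j).2.1 = true
      | .inr (.inr (.inr j)) => (s.1 j).2.2 = true}, ?_⟩
    refine Prod.ext (funext fun j => Prod.ext (funext fun l => ?_) (Prod.ext ?_ ?_))
      (funext fun q => ?_) <;> simp [digraphCoreState]

abbrev digraphBlockWidth : T6 ⊕ (F6 × Fin 2) → Fin 690 → ℕ
  | .inl _, _ => 5
  | .inr _, _ => 1

/-- The edges at a pendant vertex, and the single parallel edges. -/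
def digraphBlock : ∀ (b : T6 ⊕ (F6 × Fin 2)) (j : Fin 690), Fin (digraphBlockWidth b j) →
    D7BunkbedEdge
  | .inl t, j => ![.inl (.inr (.inl (t, j)), 0), .inl (.inr (.inl (t, j)), 1),
      .inl (.inr (.inr (t, j)), 0), .inl (.inr (.inr (t, j)), 1), .inr (.inr (t, j))]
  | .inr (e, l), j => fun _ => .inl (.inl (.inr (e, j)), l)

theorem digraphBlock_injective (b : T6 ⊕ (F6 × Fin 2)) :
    Function.Injective fun p : Σ j, Fin (digraphBlockWidth b j) => digraphBlock b p.1 p.2 := by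
  rcases b with t | ⟨e, l⟩
  · rintro ⟨j, x⟩ ⟨j', x'⟩ h
    change Fin 5 at x x'
    fin_cases x <;> fin_cases x' <;> simp [digraphBlock] at h ⊢ <;> exact h
  · rintro ⟨j, x⟩ ⟨j', x'⟩ h
    obtain rfl : j = j' := by simpa [digraphBlock] using h
    change Fin 1 at x x'
    obtain rfl : x = x' := Subsingleton.elim _ _
    rfl

theorem digraphBlock_ne_digraphCoreEdge (b : T6 ⊕ (F6 × Fin 2)) (j : Fin 690)
    (x : Fin (digraphBlockWidth b j)) (i : DigraphCore) :
    digraphBlock b j x ≠ digraphCoreEdge i := by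
  rcases b with t | ⟨e, l⟩
  · change Fin 5 at x
    fin_cases x <;> rcases i with ⟨j, m⟩ | r | j | j <;> simp [digraphBlock, digraphCoreEdge]
  · rcases i with ⟨j, m⟩ | r | j | j <;> simp [digraphBlock, digraphCoreEdge]

/-- The vertices of `D6` from which one gets to a vertex over `D7`. -/
def gadgetShadow (w : GadgetVertex T6 690 × Fin 2) (p : D6Vertex × Fin 2) : Prop :=
  match w.1 with
  | .inl d => p = (d, w.2)
  | .inr (t, _) => p.1 = t

/-- If every edge of `F6` has a retained parallel copy in each layer and every post has a complete
pendant detour, then `D7` behaves like `D6` with working posts. The vertical edge at a post itself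
is then irrelevant. -/
theorem conn_D7_iff {X : Set (D7BunkbedEdge)}
    (hX : ∀ b, ∃ j, ∀ x, digraphBlock b j x ∈ X) (p q : D6Vertex × Fin 2) :
    Conn (bunkbed (ofMultiDigraph D7)) X (.inl p.1, p.2) (.inl q.1, q.2) ↔
      Relation.ReflTransGen (DigraphStep (digraphCoreState (digraphCoreEdge ⁻¹' X))) p q := by
  refine reflTransGen_iff_of_shadow
    (fun p : D6Vertex × Fin 2 => ((Sum.inl p.1, p.2) : GadgetVertex T6 690 × Fin 2)) gadgetShadow
    ?_ ?_ (fun p => rfl) ?_ p q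
  · have hF : ∀ e : F6, ∀ l, ∃ k, (Sum.inl (.inl (.inr (e, k)), l) : D7BunkbedEdge) ∈ X :=
      fun e l => let ⟨k, hk⟩ := hX (.inr (e, l)); ⟨k, hk (0 : Fin 1)⟩
    intro p q hs
    cases hs with
    | enter v j l hv =>
      obtain ⟨k, hk⟩ := hF ⟨enterEdge v j hv, enterEdge_mem_F6 _ _ hv⟩ l
      exact .single ⟨_, hk, rfl, rfl, rfl, rfl⟩
    | middle j l h =>
      have h' : digraphCoreEdge (.inl (j, l)) ∈ X := by simpa [digraphCoreState] using h
      exact .single ⟨_, h', rfl, rfl, rfl, rfl⟩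
    | leave v j l hv =>
      obtain ⟨k, hk⟩ := hF ⟨leaveEdge v j hv, leaveEdge_mem_F6 _ _ hv⟩ l
      exact .single ⟨_, hk, rfl, rfl, rfl, rfl⟩
    | vertEnter j l m hlm h =>
      have h' : digraphCoreEdge (.inr (.inr (.inl j))) ∈ X := by simpa [digraphCoreState] using h
      exact .single ⟨_, h', rfl, rfl, hlm⟩
    | vertExit j l m hlm h =>
      have h' : digraphCoreEdge (.inr (.inr (.inr j))) ∈ X := by simpa [digraphCoreState] using h
      exact .single ⟨_, h', rfl, rfl, hlm⟩
    | vert v l m hlm h =>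
      rcases v with q | t
      · have h' : digraphCoreEdge (.inr (.inl q)) ∈ X := by
          simpa [digraphCoreState, ChainState.Vert] using h
        exact .single ⟨_, h', rfl, rfl, hlm⟩
      · obtain ⟨k, hk⟩ := hX (.inl ⟨.old (chainToH4 (.inr t)), old_mem_T6.2 ⟨t, rfl⟩⟩)
        have hk0 := hk (0 : Fin 5)
        have hk1 := hk (1 : Fin 5)
        have hk2 := hk (2 : Fin 5)
        have hk3 := hk (3 : Fin 5)
        have hk4 := hk (4 : Fin 5)
        have hl : l = 0 ∧ m = 1 ∨ l = 1 ∧ m = 0 := by omega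
        rcases hl with ⟨rfl, rfl⟩ | ⟨rfl, rfl⟩
        -- The detour: go to the pendant vertex, change the layer there, and return.
        · refine .head (b := (.inr (_, k), 0)) ⟨_, hk0, rfl, rfl, rfl, rfl⟩ ?_
          refine .head (b := (.inr (_, k), 1)) ⟨_, hk4, rfl, rfl, hlm⟩ ?_
          exact .single ⟨_, hk3, rfl, rfl, rfl, rfl⟩
        · refine .head (b := (.inr (_, k), 1)) ⟨_, hk1, rfl, rfl, rfl, rfl⟩ ?_
          refine .head (b := (.inr (_, k), 0)) ⟨_, hk4, rfl, rfl, hlm⟩ ?_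
          exact .single ⟨_, hk2, rfl, rfl, rfl, rfl⟩
  · rintro ⟨a, l⟩ ⟨b, m⟩ p ⟨⟨e, i⟩ | v, he, hj⟩ hp
    · obtain ⟨h1, h2, h3, h4⟩ : l = i ∧ m = i ∧ D7.src e = a ∧ D7.tgt e = b := hj
      subst h1 h2 h3 h4
      rcases e with (e | ⟨e, k⟩) | (⟨t, k⟩ | ⟨t, k⟩)
      · obtain ⟨e, hF⟩ := e
        obtain ⟨j, rfl⟩ := exists_eq_middleEdge hF
        obtain rfl : p = (.x (cellEdge j), _) := hp
        refine ⟨_, .single (.middle j _ ?_), rfl⟩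
        simpa [digraphCoreState] using (show digraphCoreEdge (.inl (j, _)) ∈ X from he)
      · obtain ⟨⟨⟨a, b⟩, hab⟩, hF⟩ := e
        obtain rfl : p = (a, _) := hp
        refine ⟨(b, _), .single ?_, rfl⟩
        cases hab with
        | enter u f hu =>
          obtain ⟨j, rfl⟩ := cellEdge_surjective f
          obtain ⟨v, rfl⟩ := chainToH4_surjective u
          exact .enter _ _ _ (chainToH4_mem_cellSet.1 hu)
        | middle f => exact absurd rfl (hF f)
        | leave u f hu =>
          obtain ⟨j, rfl⟩ := cellEdge_surjective f
          obtain ⟨v, rfl⟩ := chainToH4_surjective u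
          exact .leave _ _ _ (chainToH4_mem_cellSet.1 hu)
      · obtain rfl : p = (t.1, _) := hp
        exact ⟨_, .refl, rfl⟩
      -- At a pendant vertex the shadow does not fix the layer, so the return may require a change
      -- of layer, which the post provides.
      · obtain ⟨a, l⟩ := p
        obtain rfl : a = t.1 := hp
        refine ⟨(t.1, _), ?_, rfl⟩
        obtain ⟨_, u, hu, rfl⟩ := t
        obtain ⟨v, rfl⟩ := chainToH4_surjective u
        obtain ⟨t, rfl⟩ := chainToH4_mem_T4.1 hu
        by_cases hl : l = m
        · rw [hl]
        · exact .single (.vert _ _ _ hl trivial)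
    · obtain ⟨rfl, h2, hlm⟩ : a = v ∧ b = v ∧ l ≠ m := hj
      subst h2
      rcases b with d | ⟨t, k⟩
      · obtain rfl : p = (d, _) := hp
        refine ⟨(d, m), .single ?_, rfl⟩
        rcases d with u | f | f
        · obtain ⟨v, rfl⟩ := chainToH4_surjective u
          refine .vert _ _ _ hlm ?_
          rcases v with q | t
          · simpa [digraphCoreState, ChainState.Vert] using 
            (show digraphCoreEdge (.inr (.inl q)) ∈ X from he)
          · trivial
        · obtain ⟨j, rfl⟩ := cellEdge_surjective f
          refine .vertEnter _ _ _ hlm ?_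
          simpa [digraphCoreState] using 
            (show digraphCoreEdge (.inr (.inr (.inl j))) ∈ X from he)
        · obtain ⟨j, rfl⟩ := cellEdge_surjective f
          refine .vertExit _ _ _ hlm ?_
          simpa [digraphCoreState] using 
            (show digraphCoreEdge (.inr (.inr (.inr j))) ∈ X from he)
      · exact ⟨p, .refl, hp⟩
  · intro p q h
    obtain rfl : p = q := h
    exact .refl

theorem nat_card_T4 : Nat.card T4 = 3 := by
  rw [Nat.card_coe_set_eq, T4, Set.ncard_eq_toFinset_card']
  rfl

theorem nat_card_T6 : Nat.card T6 = 3 := by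
  rw [T6, Nat.card_image_of_injective (fun _ _ h => D6Vertex.old.inj h), nat_card_T4]

theorem nat_card_D7_vertex : Nat.card (GadgetVertex T6 690) = 2092 := by
  rw [Nat.card_sum, Nat.card_prod, nat_card_T6, nat_card_D6Vertex, Nat.card_fin]

set_option exponentiation.threshold 1000 in
theorem E7_prob_lt : (E7 D7).prob (.inl (.old 0), 0) (.inl (.old 9), 0) <
    (E7 D7).prob (.inl (.old 0), 0) (.inl (.old 9), 1) := by
  have : Finite (E7 D7).Outcome := inferInstanceAs (Finite (Set (D7BunkbedEdge)))
  have := Fintype.ofFinite T6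
  have := Fintype.ofFinite F6
  apply (E7 D7).prob_lt_prob_of_univ rfl
  have hconn : ∀ i X, (∀ b, ∃ j, ∀ x, digraphBlock b j x ∈ X) →
      (Conn (bunkbed (ofMultiDigraph D7)) X (.inl (.old 0), 0) (.inl (.old 9), i) ↔
        (digraphCoreState (digraphCoreEdge ⁻¹' X)).Hits i) := fun i X hX =>
    (conn_D7_iff hX (.old 0, 0) (.old 9, i)).trans
      (digraphStep_reflTransGen_iff _ (.inl 0, 0) (.inl 6, i))
  have hcount : ∀ i, {S | (digraphCoreState S).Hits i}.ncard = {s : ChainState | s.Hits i}.ncard := by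
    intro i
    rw [← Set.ncard_image_of_injective _ digraphCoreState_bijective.1]
    congr 1
    exact Set.image_preimage_eq {s : ChainState | s.Hits i} digraphCoreState_bijective.2
  have h := ncard_lt_ncard_of_core digraphCoreEdge_injective digraphBlock digraphBlock_injective
    digraphBlock_ne_digraphCoreEdge (m := 4) (c₀ := fun S => (digraphCoreState S).Hits 0)
    (c₁ := fun S => (digraphCoreState S).Hits 1)
    (fun X hX h => (hconn 0 X hX).1 h) (fun X hX h => (hconn 1 X hX).2 h)
    (by rw [hcount, hcount]; exact ncard_hits_directed) ?_
  · exact h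
  -- The crude bound `22 ^ 2` on the number of edges suffices, as each fails in a layer with
  -- probability only `2 ^ (-690)`. The main term is `3 * (31 / 32) ^ 690`: a pendant vertex works
  -- if its four edges and its vertical edge are retained.
  · have h6 : Fintype.card F6 ≤ 484 := by
      rw [← Nat.card_eq_fintype_card]
      have : Nat.card F6 ≤ Nat.card (D6Vertex × D6Vertex) :=
        Nat.card_le_card_of_injective (fun e : F6 => e.1.1)
          (fun a b h => Subtype.ext (Subtype.ext h))
      rwa [Nat.card_prod, nat_card_D6Vertex] at this
    have h3 : Fintype.card T6 = 3 := by rw [← Nat.card_eq_fintype_card, nat_card_T6]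
    -- There are 12 copies of middle edges, and vertical edges at 7 vertices of the path, 6
    -- entrances and 6 exits.
    have hI : Nat.card DigraphCore = 31 := by simp
    rw [hI, Fintype.sum_sum_type]
    change (∑ _ : T6, ∏ _ : Fin 690, (1 - (1 / 2) ^ 5 : ℚ) +
      ∑ _ : F6 × Fin 2, ∏ _ : Fin 690, (1 - (1 / 2) ^ 1 : ℚ)) * _ < _
    simp only [Finset.prod_const, Finset.card_univ, Fintype.card_fin, Finset.sum_const,
      Fintype.card_prod, h3, nsmul_eq_mul]
    have h6' : (Fintype.card F6 : ℚ) ≤ 484 := by exact_mod_cast h6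
    calc _ ≤ ((3 : ℕ) * (1 - (1 / 2) ^ 5 : ℚ) ^ 690 + (484 * 2) * (1 - (1 / 2) ^ 1) ^ 690) *
          (2 ^ 31 + (4 : ℕ)) := by
            push_cast
            gcongr
      _ < _ := by norm_num

/-! ### The hypergraph `H4` with conditioned hyperedges -/

/-- The retained edges over `H4` if the hyperedge of the cell `j` is retained in layer `c j`. -/
def hypergraphOutcome (c : Fin 6 → Fin 2) : Set ((H4.edgeSet × Fin 2) ⊕ H4.vertexSet) :=
  bondSet (layerSet ∅ cellEdge c) {v | v.1 ∈ T4}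

theorem E4_outcomes : (E4 H4 {v | v.1 ∈ T4}).outcomes = Set.range hypergraphOutcome := by
  refine Eq.trans ?_ (range_bondSet {v : H4.vertexSet | v.1 ∈ T4}
    (range_layerSet (F := ∅) cellEdge_injective fun e => ?_))
  · ext X
    refine and_congr_left fun _ => forall_congr' fun e => ?_
    exact ⟨fun h => ⟨fun h' => h'.elim, fun _ => h⟩, fun h => h.2 (Set.notMem_empty e)⟩
  · obtain ⟨j, rfl⟩ := cellEdge_surjective e
    exact iff_of_true (Set.notMem_empty _) ⟨j, rfl⟩

theorem hypergraphOutcome_injective : Function.Injective hypergraphOutcome :=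
  (bondSet_injective _).comp (layerSet_injective cellEdge_injective fun _ => Set.notMem_empty _)

theorem ChainState.eq_of_passes {s : ChainState} (hs : ∀ j, (s.1 j).2 = (false, false))
    {j : Fin 6} {l m : Fin 2} (h : (s.1 j).Passes l m) : l = m ∧ (s.1 j).1 l = true := by
  obtain ⟨k, h1, h2, h3⟩ := h
  simp only [hs j, Bool.false_eq_true, or_false] at h1 h3
  rw [h1, ← h3]; exact ⟨rfl, h2⟩

theorem ChainState.passes_self {s : ChainState} {j : Fin 6} {l : Fin 2} (h : (s.1 j).1 l = true) :
    (s.1 j).Passes l l := ⟨l, Or.inl rfl, h, Or.inl rfl⟩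

/-- Without vertical edges at entrance and exit, crossing a cell keeps the layer, so it is the same
as a step within the retained copy of the hyperedge. -/
theorem conn_hypergraphOutcome_iff (c : Fin 6 → Fin 2) (p q : ChainVertex × Fin 2) :
    Conn (bunkbed (ofHypergraph H4)) (hypergraphOutcome c) (H4vertex (chainToH4 p.1), p.2)
      (H4vertex (chainToH4 q.1), q.2) ↔ (layerState c).Reach p q := by
  refine reflTransGen_iff_of_shadow
    (fun p : ChainVertex × Fin 2 => (H4vertex (chainToH4 p.1), p.2))
    (fun w p => chainToH4 p.1 = w.1.1 ∧ p.2 = w.2) ?_ ?_ (fun p => ⟨rfl, rfl⟩) ?_ p q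
  · rintro ⟨v, l⟩ ⟨w, m⟩ (⟨j, hv, hw, h⟩ | ⟨h1, h2⟩)
    · obtain ⟨h3, h4⟩ := ChainState.eq_of_passes (fun _ => rfl) h
      simp only at h3 h4
      subst h3
      exact .single ⟨.inl (cellEdge j, l), Or.inr ⟨j, rfl, by simpa [layerState] using h4⟩, rfl, rfl,
        chainToH4_mem_cellSet.2 hv, chainToH4_mem_cellSet.2 hw⟩
    · simp only at h1 h2
      subst h1
      by_cases hlm : l = m
      · rw [hlm]
      · rcases v with q | t
        · simp [ChainState.Vert, layerState] at h2
        · exact .single ⟨.inr (H4vertex (chainToH4 (.inr t))), chainToH4_mem_T4.2 ⟨t, rfl⟩,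
            rfl, rfl, hlm⟩
  · rintro ⟨a, l⟩ ⟨b, m⟩ ⟨v, l'⟩ ⟨⟨e, i⟩ | x, he, hj⟩ ⟨h1, h2⟩
    · obtain ⟨h3, h4, h5, h6⟩ : l = i ∧ m = i ∧ a.1 ∈ e.1 ∧ b.1 ∈ e.1 := hj
      simp only at h1 h2
      subst h3 h4 h2
      obtain ⟨j, rfl, hl⟩ : ∃ j, e = cellEdge j ∧ l' = c j := he.resolve_left (Set.notMem_empty _)
      obtain ⟨w, hw⟩ := chainToH4_surjective b.1
      rw [← h1] at h5
      rw [← hw] at h6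
      refine ⟨(w, l'), .single (ChainState.cell_step (chainToH4_mem_cellSet.1 h5)
        (chainToH4_mem_cellSet.1 h6) (ChainState.passes_self ?_)), hw, rfl⟩
      simpa [layerState] using hl
    · obtain ⟨h3, h4, -⟩ : a = x ∧ b = x ∧ l ≠ m := hj
      subst h3 h4
      have hT : b.1 ∈ T4 := he
      rw [← h1] at hT
      obtain ⟨t, rfl⟩ := chainToH4_mem_T4.1 hT
      exact ⟨(.inr t, m), .single (Or.inr ⟨rfl, trivial⟩), h1, rfl⟩
  · rintro ⟨v, l⟩ ⟨w, m⟩ ⟨h1, h2⟩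
    obtain rfl := chainToH4_injective h1
    obtain rfl : l = m := h2
    exact .refl

theorem E4_prob_lt : (E4 H4 {v | v.1 ∈ T4}).prob (H4vertex 0, 0) (H4vertex 9, 0) <
    (E4 H4 {v | v.1 ∈ T4}).prob (H4vertex 0, 0) (H4vertex 9, 1) := by
  have : Finite (E4 H4 {v | v.1 ∈ T4}).Outcome :=
    inferInstanceAs (Finite (Set ((H4.edgeSet × Fin 2) ⊕ H4.vertexSet)))
  exact (E4 H4 {v | v.1 ∈ T4}).prob_lt_prob_of_layerState (y := fun i => (H4vertex 9, i))
    hypergraphOutcome_injective E4_outcomes fun c i =>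
      conn_hypergraphOutcome_iff c (.inl 0, 0) (.inl 6, i)

/-! ### The hypergraph `H5` -/

theorem H5_edge_of_mem {f : Set (Fin 10)} (hf : f ∈ H4.edgeSet) : Sum.inl '' f ∈ H5.edgeSet :=
  Or.inl ⟨f, hf, rfl⟩

def cellEdgeH5 (j : Fin 6) : H5.edgeSet := ⟨Sum.inl '' cellSet j, H5_edge_of_mem (cellEdge j).2⟩

def pendantEdgeH5 (t : T4) (i : Fin 102) : H5.edgeSet :=
  ⟨{Sum.inl t.1, Sum.inr (t, i)}, Or.inr ⟨t, i, rfl⟩⟩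

theorem cellEdgeH5_injective : Function.Injective cellEdgeH5 := fun _ _ h =>
  cellSet_injective (Sum.inl_injective.image_injective (congrArg Subtype.val h))

theorem inr_mem_pendantEdgeH5 {t : T4} {i : Fin 102} {x : T4 × Fin 102} :
    Sum.inr x ∈ (pendantEdgeH5 t i).1 ↔ x = (t, i) := by
  simp [pendantEdgeH5]

theorem pendantEdgeH5_injective (t : T4) : Function.Injective (pendantEdgeH5 t) := by
  intro i i' h
  have : Sum.inr (t, i) ∈ (pendantEdgeH5 t i').1 := h ▸ inr_mem_pendantEdgeH5.2 rfl
  exact (Prod.ext_iff.1 (inr_mem_pendantEdgeH5.1 this)).2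

theorem pendantEdgeH5_ne_cellEdgeH5 (t : T4) (i : Fin 102) (j : Fin 6) :
    pendantEdgeH5 t i ≠ cellEdgeH5 j := by
  intro h
  have : Sum.inr (t, i) ∈ (cellEdgeH5 j).1 := h ▸ inr_mem_pendantEdgeH5.2 rfl
  obtain ⟨_, _, h⟩ := this
  cases h

def pendantVertexH5 (t : T4) (i : Fin 102) : H5.vertexSet := ⟨.inr (t, i), trivial⟩

theorem H5vertex_injective : Function.Injective H5vertex := fun _ _ h =>
  Sum.inl_injective (congrArg Subtype.val h)

theorem pendantVertexH5_injective (t : T4) : Function.Injective (pendantVertexH5 t) :=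
  fun _ _ h => (Prod.ext_iff.1 (Sum.inr_injective (congrArg Subtype.val h))).2

theorem pendantVertexH5_ne_H5vertex (t : T4) (i : Fin 102) (u : Fin 10) :
    pendantVertexH5 t i ≠ H5vertex u := fun h => by
  have := congrArg Subtype.val h
  cases this

abbrev H5BunkbedEdge : Type := (H5.edgeSet × Fin 2) ⊕ H5.vertexSet

/-- The edges over `H5` that determine the state of the chain: the hyperedges from `H4`, and the
vertical edges at vertices from `H4` outside `T4`. -/
def hypergraphCoreEdge : (Fin 6 × Fin 2) ⊕ Fin 7 → H5BunkbedEdge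
  | .inl (j, l) => .inl (cellEdgeH5 j, l)
  | .inr q => .inr (H5vertex (chainToH4 (.inl q)))

theorem hypergraphCoreEdge_injective : Function.Injective hypergraphCoreEdge := by
  rintro (⟨i, l⟩ | q) (⟨j, m⟩ | r) h <;>
    simp [hypergraphCoreEdge, cellEdgeH5_injective.eq_iff, chainToH4_injective.eq_iff,
      H5vertex_injective.eq_iff] at h ⊢
  all_goals exact h

open Classical in
noncomputable def hypergraphCoreState (S : Set ((Fin 6 × Fin 2) ⊕ Fin 7)) : ChainState :=
  (fun j => (fun l => decide (.inl (j, l) ∈ S), false, false), fun q => decide (.inr q ∈ S))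

theorem hypergraphCoreState_injective : Function.Injective hypergraphCoreState := by
  intro S S' h
  simp only [hypergraphCoreState, Prod.mk.injEq, funext_iff, decide_eq_decide] at h
  ext i
  rcases i with ⟨j, l⟩ | q
  exacts [(h.1 j).1 l, h.2 q]

theorem range_hypergraphCoreState :
    Set.range hypergraphCoreState = {s | ∀ j, (s.1 j).2 = (false, false)} := by
  ext s
  constructor
  · rintro ⟨S, rfl⟩ j; rfl
  · intro h
    refine ⟨{i | match i with
      | .inl (j, l) => (s.1 j).1 l = true
      | .inr q => s.2 q = true}, ?_⟩
    refine Prod.ext (funext fun j => Prod.ext (funext fun l => ?_) (h j).symm)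
      (funext fun q => ?_) <;> simp [hypergraphCoreState]

abbrev hypergraphBlockWidth : T4 → Option (Fin 102) → ℕ
  | _, none => 1
  | _, some _ => 3

/-- The ways to change the layer at a post: its vertical edge, or the pendant edges. -/
def hypergraphBlock : ∀ (t : T4) (j : Option (Fin 102)), Fin (hypergraphBlockWidth t j) →
    H5BunkbedEdge
  | t, none => fun _ => .inr (H5vertex t.1)
  | t, some i => ![.inl (pendantEdgeH5 t i, 0), .inl (pendantEdgeH5 t i, 1),
      .inr (pendantVertexH5 t i)]

theorem hypergraphBlock_injective (t : T4) :
    Function.Injective fun p : Σ j, Fin (hypergraphBlockWidth t j) =>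
      hypergraphBlock t p.1 p.2 := by
  rintro ⟨_ | j, x⟩ ⟨_ | j', x'⟩ h
  · change Fin 1 at x x'
    obtain rfl : x = x' := Subsingleton.elim _ _
    rfl
  · change Fin 1 at x
    change Fin 3 at x'
    fin_cases x' <;> simp [hypergraphBlock, (pendantVertexH5_ne_H5vertex _ _ _).symm] at h
  · change Fin 3 at x
    change Fin 1 at x'
    fin_cases x <;> simp [hypergraphBlock, pendantVertexH5_ne_H5vertex] at h
  · change Fin 3 at x x'
    fin_cases x <;> fin_cases x' <;> simp [hypergraphBlock, (pendantEdgeH5_injective t).eq_iff,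
      (pendantVertexH5_injective t).eq_iff] at h ⊢ <;> exact h

theorem hypergraphBlock_ne_hypergraphCoreEdge (t : T4) (j : Option (Fin 102))
    (x : Fin (hypergraphBlockWidth t j)) (i : (Fin 6 × Fin 2) ⊕ Fin 7) :
    hypergraphBlock t j x ≠ hypergraphCoreEdge i := by
  rcases j with _ | j
  · rcases i with ⟨j, m⟩ | q
    · simp [hypergraphBlock, hypergraphCoreEdge]
    · simp only [hypergraphBlock, hypergraphCoreEdge, ne_eq, Sum.inr.injEq,
        H5vertex_injective.eq_iff]
      intro h
      obtain ⟨t', h'⟩ := chainToH4_mem_T4.1 (h ▸ t.2)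
      cases h'
  · change Fin 3 at x
    fin_cases x <;> rcases i with ⟨j, m⟩ | r <;> simp [hypergraphBlock, hypergraphCoreEdge,
      pendantEdgeH5_ne_cellEdgeH5, pendantVertexH5_ne_H5vertex]

/-- The vertices of the chain from which one gets to a vertex over `H5`. -/
def hypergraphShadow (w : H5.vertexSet × Fin 2) (p : ChainVertex × Fin 2) : Prop :=
  match w.1.1 with
  | .inl u => chainToH4 p.1 = u ∧ p.2 = w.2
  | .inr (t, _) => chainToH4 p.1 = t

/-- Once every post has its vertical edge or a complete pendant detour, `H5` behaves like `H4` with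
working posts. A visit to a pendant vertex can only end at its post, possibly in the other layer. -/
theorem conn_H5_iff {X : Set H5BunkbedEdge} (hX : ∀ t, ∃ j, ∀ x, hypergraphBlock t j x ∈ X)
    (p q : ChainVertex × Fin 2) :
    Conn (bunkbed (ofHypergraph H5)) X (H5vertex (chainToH4 p.1), p.2)
      (H5vertex (chainToH4 q.1), q.2) ↔
      (hypergraphCoreState (hypergraphCoreEdge ⁻¹' X)).Reach p q := by
  refine reflTransGen_iff_of_shadow
    (fun p : ChainVertex × Fin 2 => (H5vertex (chainToH4 p.1), p.2)) hypergraphShadow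
    ?_ ?_ (fun p => ⟨rfl, rfl⟩) ?_ p q
  · rintro ⟨v, l⟩ ⟨w, m⟩ (⟨j, hv, hw, h⟩ | ⟨h1, h2⟩)
    · obtain ⟨h3, h4⟩ := ChainState.eq_of_passes (fun _ => rfl) h
      simp only at h3 h4
      subst h3
      have h' : hypergraphCoreEdge (.inl (j, l)) ∈ X := by simpa [hypergraphCoreState] using h4
      exact .single ⟨_, h', rfl, rfl, ⟨_, chainToH4_mem_cellSet.2 hv, rfl⟩,
        ⟨_, chainToH4_mem_cellSet.2 hw, rfl⟩⟩
    · simp only at h1 h2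
      subst h1
      by_cases hlm : l = m
      · rw [hlm]
      · rcases v with q | t
        · have h' : hypergraphCoreEdge (.inr q) ∈ X := by
            simpa [hypergraphCoreState, ChainState.Vert] using h2
          exact .single ⟨_, h', rfl, rfl, hlm⟩
        · have ht : chainToH4 (.inr t) ∈ T4 := chainToH4_mem_T4.2 ⟨t, rfl⟩
          obtain ⟨_ | k, hk⟩ := hX ⟨_, ht⟩
          · exact .single ⟨_, hk (0 : Fin 1), rfl, rfl, hlm⟩
          · have hk' : ∀ i : Fin 2, (.inl (pendantEdgeH5 ⟨_, ht⟩ k, i) : H5BunkbedEdge) ∈ X := by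
              rw [Fin.forall_fin_two]; exact ⟨hk (0 : Fin 3), hk (1 : Fin 3)⟩
            refine .head (b := (pendantVertexH5 ⟨_, ht⟩ k, l)) ⟨_, hk' l, rfl, rfl, ?_, ?_⟩ ?_
            · exact Or.inl rfl
            · exact Or.inr rfl
            refine .head (b := (pendantVertexH5 ⟨_, ht⟩ k, m)) ⟨_, hk (2 : Fin 3), rfl, rfl, hlm⟩ ?_
            exact .single ⟨_, hk' m, rfl, rfl, Or.inr rfl, Or.inl rfl⟩
  · rintro ⟨⟨a, ha⟩, l⟩ ⟨⟨b, hb⟩, m⟩ ⟨v, l'⟩ ⟨⟨e, i⟩ | x, he, hj⟩ hp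
    · obtain ⟨h3, h4, h5, h6⟩ : l = i ∧ m = i ∧ a ∈ e.1 ∧ b ∈ e.1 := hj
      subst h3 h4
      obtain ⟨e, ⟨f, hf, rfl⟩ | ⟨t, k, rfl⟩⟩ := e
      · obtain ⟨u, hu, rfl⟩ := h5
        obtain ⟨u', hu', rfl⟩ := h6
        obtain ⟨rfl, rfl⟩ : chainToH4 v = u ∧ l' = _ := hp
        obtain ⟨w, rfl⟩ := chainToH4_surjective u'
        obtain ⟨j, hj⟩ := cellEdge_surjective ⟨f, hf⟩
        obtain rfl : cellSet j = f := congrArg Subtype.val hj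
        refine ⟨(w, l'), .single (ChainState.cell_step (chainToH4_mem_cellSet.1 hu)
          (chainToH4_mem_cellSet.1 hu') (ChainState.passes_self ?_)), rfl, rfl⟩
        simpa [hypergraphCoreState] using (show hypergraphCoreEdge (.inl (j, l')) ∈ X from he)
      · have hv : chainToH4 v = t.1 := by
          rcases h5 with rfl | rfl
          exacts [hp.1, hp]
        rcases h6 with rfl | rfl
        · obtain ⟨t', rfl⟩ := chainToH4_mem_T4.1 (hv ▸ t.2)
          exact ⟨(.inr t', m), .single (Or.inr ⟨rfl, trivial⟩), hv, rfl⟩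
        · exact ⟨_, .refl, hv⟩
    · obtain ⟨h3, h4, -⟩ : (⟨a, ha⟩ : H5.vertexSet) = x ∧ (⟨b, hb⟩ : H5.vertexSet) = x ∧ l ≠ m := hj
      subst h3
      obtain rfl : b = a := congrArg Subtype.val h4
      rcases b with u | ⟨t, k⟩
      · obtain ⟨rfl, rfl⟩ : chainToH4 v = u ∧ l' = _ := hp
        refine ⟨(v, m), .single (ChainState.Vert.step ?_ _ _), rfl, rfl⟩
        rcases v with q | t
        · simpa [hypergraphCoreState, ChainState.Vert] using
            (show hypergraphCoreEdge (.inr q) ∈ X from he)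
        · trivial
      · exact ⟨_, .refl, hp⟩
  · rintro ⟨v, l⟩ ⟨w, m⟩ ⟨h1, h2⟩
    obtain rfl := chainToH4_injective h1
    obtain rfl : l = m := h2
    exact .refl

theorem nat_card_H5_vertexSet : Nat.card H5.vertexSet = 316 := by
  have : Nat.card H5.vertexSet = Nat.card (Fin 10 ⊕ (T4 × Fin 102)) := Nat.card_univ
  rw [this, Nat.card_sum, Nat.card_prod, nat_card_T4, Nat.card_fin, Nat.card_fin]

set_option exponentiation.threshold 1000 in
theorem E5_prob_lt : (E5 H5).prob (H5vertex 0, 0) (H5vertex 9, 0) <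
    (E5 H5).prob (H5vertex 0, 0) (H5vertex 9, 1) := by
  have : Finite (E5 H5).Outcome := inferInstanceAs (Finite (Set H5BunkbedEdge))
  have := Fintype.ofFinite T4
  apply (E5 H5).prob_lt_prob_of_univ rfl
  have hconn : ∀ i X, (∀ t, ∃ j, ∀ x, hypergraphBlock t j x ∈ X) →
      (Conn (bunkbed (ofHypergraph H5)) X (H5vertex 0, 0) (H5vertex 9, i) ↔
        (hypergraphCoreState (hypergraphCoreEdge ⁻¹' X)).Hits i) := fun i X hX =>
    conn_H5_iff hX (.inl 0, 0) (.inl 6, i)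
  have hcount : ∀ i, {S | (hypergraphCoreState S).Hits i}.ncard =
      {s : ChainState | (∀ j, (s.1 j).2 = (false, false)) ∧ s.Hits i}.ncard := by
    intro i
    rw [← Set.ncard_image_of_injective _ hypergraphCoreState_injective]
    congr 1
    refine (Set.image_preimage_eq_range_inter (t := {s : ChainState | s.Hits i})
      (f := hypergraphCoreState)).trans ?_
    rw [range_hypergraphCoreState]; rfl
  have h := ncard_lt_ncard_of_core hypergraphCoreEdge_injective hypergraphBlock
    hypergraphBlock_injective hypergraphBlock_ne_hypergraphCoreEdge (m := 1)
    (c₀ := fun S => (hypergraphCoreState S).Hits 0) (c₁ := fun S => (hypergraphCoreState S).Hits 1)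
    (fun X hX h => (hconn 0 X hX).1 h) (fun X hX h => (hconn 1 X hX).2 h)
    (by rw [hcount, hcount]; exact ncard_hits_undirected) ?_
  · exact h
  · have h3 : Fintype.card T4 = 3 := by rw [← Nat.card_eq_fintype_card, nat_card_T4]
    have hI : Nat.card ((Fin 6 × Fin 2) ⊕ Fin 7) = 19 := by simp
    rw [hI]
    -- A post fails with probability `(1 / 2) * (7 / 8) ^ 102`, the first factor belonging to its
    -- own vertical edge. Three times this is less than `1 / (2 ^ 19 + 1)`.
    simp only [Fintype.prod_option]
    norm_num [h3]

/-! ### The graphs `G2` and `G1` -/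

/-- The vertices of `G2` outside `T2`, which correspond to the cells. -/
def siteCell : Fin 6 → Fin 9 := ![0, 4, 3, 2, 5, 8]

/-- The vertices in `T2`. -/
def sitePost : Fin 3 → Fin 9 := ![1, 7, 6]

theorem siteCell_injective : Function.Injective siteCell := by
  unfold Function.Injective; decide

theorem notMem_T2_iff {v : Fin 9} : v ∉ T2 ↔ ∃ j, v = siteCell j := by
  simp only [T2, Set.mem_insert_iff, Set.mem_singleton_iff]
  revert v; decide

theorem sitePost_mem_T2 (t : Fin 3) : sitePost t ∈ T2 := by
  simp only [T2, Set.mem_insert_iff, Set.mem_singleton_iff]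
  revert t; decide

theorem eq_siteCell_or_sitePost (v : Fin 9) : (∃ j, v = siteCell j) ∨ ∃ t, v = sitePost t := by
  revert v; decide

theorem siteCell_ne_sitePost (j : Fin 6) (t : Fin 3) : siteCell j ≠ sitePost t := by
  revert j t; decide

theorem G2_adj_siteCell (i j : Fin 6) :
    G2.Adj (siteCell i) (siteCell j) ↔ i.succ = j.castSucc ∨ j.succ = i.castSucc := by
  simp only [G2, SimpleGraph.fromEdgeSet_adj, Set.mem_insert_iff, Set.mem_singleton_iff]
  revert i j; decide

theorem G2_adj_siteCell_sitePost (j : Fin 6) (t : Fin 3) :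
    G2.Adj (siteCell j) (sitePost t) ↔ cellPost j = t := by
  simp only [G2, SimpleGraph.fromEdgeSet_adj, Set.mem_insert_iff, Set.mem_singleton_iff]
  revert j t; decide

theorem not_G2_adj_sitePost (t t' : Fin 3) : ¬ G2.Adj (sitePost t) (sitePost t') := by
  simp only [G2, SimpleGraph.fromEdgeSet_adj, Set.mem_insert_iff, Set.mem_singleton_iff]
  revert t t'; decide

section

variable {V : Type} {G : SimpleGraph V} {W : Set (V × Fin 2)}

theorem site_step_iff {a b : V × Fin 2} :
    (∃ e ∈ {e | ends (bunkbed (ofGraph G)) e ⊆ W}, (bunkbed (ofGraph G)).Joins e a b) ↔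
      a ∈ W ∧ b ∈ W ∧ (a.2 = b.2 ∧ G.Adj a.1 b.1 ∨ a.1 = b.1 ∧ a.2 ≠ b.2) := by
  obtain ⟨x, l⟩ := a
  obtain ⟨y, m⟩ := b
  constructor
  · rintro ⟨e, he, hj⟩
    refine ⟨he ⟨_, Or.inl hj⟩, he ⟨_, Or.inr hj⟩, ?_⟩
    rcases e with ⟨⟨e, h⟩, i⟩ | v
    · obtain ⟨rfl, rfl, rfl⟩ : l = i ∧ m = i ∧ e = s(x, y) := hj
      exact Or.inl ⟨rfl, h⟩
    · obtain ⟨h1, h2, h3⟩ : x = v ∧ y = v ∧ l ≠ m := hj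
      exact Or.inr ⟨h1.trans h2.symm, h3⟩
  · rintro ⟨ha, hb, ⟨h1, h2⟩ | ⟨h1, h2⟩⟩
    · obtain rfl : l = m := h1
      refine ⟨.inl (⟨s(x, y), h2⟩, l), ?_, rfl, rfl, rfl⟩
      rintro ⟨z, k⟩ ⟨⟨z', k'⟩, h | h⟩
      · obtain ⟨rfl, -, h⟩ : k = l ∧ k' = l ∧ s(x, y) = s(z, z') := h
        rcases Sym2.eq_iff.1 h with ⟨rfl, rfl⟩ | ⟨rfl, rfl⟩ <;> assumption
      · obtain ⟨-, rfl, h⟩ : k' = l ∧ k = l ∧ s(x, y) = s(z', z) := h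
        rcases Sym2.eq_iff.1 h with ⟨rfl, rfl⟩ | ⟨rfl, rfl⟩ <;> assumption
    · obtain rfl : x = y := h1
      refine ⟨.inr x, ?_, rfl, rfl, h2⟩
      rintro ⟨z, k⟩ ⟨⟨z', k'⟩, h | h⟩
      · obtain ⟨rfl, -, -⟩ : z = x ∧ z' = x ∧ k ≠ k' := h
        have : k = l ∨ k = m := by simp only at h2; omega
        rcases this with rfl | rfl <;> assumption
      · obtain ⟨-, rfl, -⟩ : z' = x ∧ z = x ∧ k' ≠ k := h
        have : k = l ∨ k = m := by simp only at h2; omega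
        rcases this with rfl | rfl <;> assumption

-- An open copy of a vertex outside `T2` acts as the middle edge of a cell in that layer. The path
-- vertices of the chain stand for the edges between consecutive such vertices, together with the
-- two free ends, and have no vertical edges.
open Classical in
noncomputable def siteState (κ : Fin 6 → V) (W : Set (V × Fin 2)) : ChainState :=
  (fun j => (fun l => decide ((κ j, l) ∈ W), false, false), fun _ => false)

theorem siteState_passes {κ : Fin 6 → V} {j : Fin 6} {l : Fin 2} (h : (κ j, l) ∈ W) :
    ((siteState κ W).1 j).Passes l l :=
  ChainState.passes_self (by simpa [siteState] using h)

/-- Site percolation on a graph which arises from `G2` by blowing up the posts, in a situation in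
which both copies of some vertex are open for each post. -/
theorem conn_site_iff {π : V → Fin 9} (hG : ∀ x y, G.Adj x y ↔ G2.Adj (π x) (π y))
    {κ : Fin 6 → V} (hκ : ∀ j x, π x = siteCell j ↔ x = κ j)
    (hW : ∀ t, ∃ x, π x = sitePost t ∧ ∀ l, (x, l) ∈ W) (i : Fin 2) :
    Conn (bunkbed (ofGraph G)) {e | ends (bunkbed (ofGraph G)) e ⊆ W} (κ 0, 0) (κ 5, i) ↔
      (siteState κ W).Hits i := by
  set s := siteState κ W
  have hπκ : ∀ j, π (κ j) = siteCell j := fun j => (hκ j _).2 rfl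
  have hcell : ∀ j v w l, (κ j, l) ∈ W → ChainMem j v → ChainMem j w → s.Reach (.inl 0, 0) (v, l) →
      s.Reach (.inl 0, 0) (w, l) := fun j v w l hl hv hw h =>
    h.tail (ChainState.cell_step hv hw (siteState_passes hl))
  have hpost : ∀ t l m, s.Reach (.inl 0, 0) (.inr t, l) → s.Reach (.inl 0, 0) (.inr t, m) :=
    fun t l m h => h.tail (Or.inr ⟨rfl, trivial⟩)
  unfold Conn
  simp only [site_step_iff]
  constructor
  · intro h
    -- The empty path would not need an open start, but it is excluded because start and target lie
    -- in different cells.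
    have h0 : (κ 0, 0) ∈ W := by
      rcases h.cases_head with h | ⟨b, hb, -⟩
      · have : siteCell 0 = siteCell 5 := by
          rw [← hπκ, ← hπκ]
          exact congrArg (fun a => π a.1) h
        exact absurd (siteCell_injective this) (by decide)
      · exact hb.1
    have key : ∀ w, Relation.ReflTransGen (fun a b => a ∈ W ∧ b ∈ W ∧
        (a.2 = b.2 ∧ G.Adj a.1 b.1 ∨ a.1 = b.1 ∧ a.2 ≠ b.2)) (κ 0, 0) w →
        (∀ j, π w.1 = siteCell j → ∀ v, ChainMem j v → s.Reach (.inl 0, 0) (v, w.2)) ∧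
        ∀ t, π w.1 = sitePost t → s.Reach (.inl 0, 0) (.inr t, w.2) := by
      intro w hw
      induction hw with
      | refl =>
        refine ⟨fun j hj v hv => ?_, fun t ht => ?_⟩
        · rw [hπκ] at hj
          obtain rfl := siteCell_injective hj
          exact hcell 0 _ _ _ h0 (Or.inl rfl) hv .refl
        · rw [hπκ] at ht
          exact absurd ht (siteCell_ne_sitePost _ _)
      | @tail a b _ hab ih =>
        obtain ⟨x, l⟩ := a
        obtain ⟨y, m⟩ := b
        obtain ⟨ha, hb, ⟨h1, h2⟩ | ⟨h1, h2⟩⟩ := hab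
        · obtain rfl : l = m := h1
          rw [hG] at h2
          simp only at ih h2 ⊢
          refine ⟨fun j hj v hv => ?_, fun t ht => ?_⟩
          · have hb' : (κ j, l) ∈ W := (hκ j y).1 hj ▸ hb
            rcases eq_siteCell_or_sitePost (π x) with ⟨i, hi⟩ | ⟨t, ht⟩
            · rw [hi, hj, G2_adj_siteCell] at h2
              rcases h2 with h2 | h2
              · exact hcell j _ _ _ hb' (Or.inl rfl) hv
                  (ih.1 i hi _ (Or.inr (Or.inl (congrArg Sum.inl h2.symm))))
              · exact hcell j _ _ _ hb' (Or.inr (Or.inl rfl)) hv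
                  (ih.1 i hi _ (Or.inl (congrArg Sum.inl h2)))
            · rw [ht, hj, SimpleGraph.adj_comm, G2_adj_siteCell_sitePost] at h2
              exact hcell j _ _ _ hb' (Or.inr (Or.inr (congrArg Sum.inr h2.symm))) hv (ih.2 t ht)
          · rcases eq_siteCell_or_sitePost (π x) with ⟨i, hi⟩ | ⟨t', ht'⟩
            · rw [hi, ht, G2_adj_siteCell_sitePost] at h2
              exact ih.1 i hi _ (Or.inr (Or.inr (congrArg Sum.inr h2.symm)))
            · rw [ht, ht'] at h2
              exact absurd h2 (not_G2_adj_sitePost _ _)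
        · obtain rfl : x = y := h1
          simp only at ih ⊢
          refine ⟨fun j hj v hv => ?_, fun t ht => hpost t l m (ih.2 t ht)⟩
          -- A vertical step at a cell has no counterpart in the chain. Since both copies of the
          -- vertex are open, it is replaced by going to the post, changing the layer there, and
          -- passing through the cell again.
          exact hcell j _ _ _ ((hκ j x).1 hj ▸ hb) (Or.inr (Or.inr rfl)) hv
            (hpost _ l m (ih.1 j hj _ (Or.inr (Or.inr rfl))))
    exact (key _ h).1 5 (hπκ 5) _ (Or.inr (Or.inl rfl))
  · intro h
    choose ξ hξ hξW using hW
    set R := fun a b : V × Fin 2 => a ∈ W ∧ b ∈ W ∧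
      (a.2 = b.2 ∧ G.Adj a.1 b.1 ∨ a.1 = b.1 ∧ a.2 ≠ b.2)
    have key : ∀ p, s.Reach (.inl 0, 0) p →
        -- The first alternative is the start itself, which is reached before any cell is known to
        -- be open.
        (∀ q, p.1 = .inl q → (q = 0 ∧ p.2 = 0) ∨ ∃ j, ChainMem j (.inl q) ∧ (κ j, p.2) ∈ W ∧
          Relation.ReflTransGen R (κ 0, 0) (κ j, p.2)) ∧
        ∀ t, p.1 = .inr t → ∀ m, Relation.ReflTransGen R (κ 0, 0) (ξ t, m) := by
      intro p hp
      induction hp with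
      | refl => exact ⟨fun q hq => Or.inl ⟨(Sum.inl.inj hq).symm, rfl⟩, by simp⟩
      | @tail a b _ hab ih =>
        obtain ⟨v, l⟩ := a
        obtain ⟨w, m⟩ := b
        rcases hab with ⟨j, hv, hw, h⟩ | ⟨h1, h2⟩
        · obtain ⟨h3, h4⟩ := ChainState.eq_of_passes (fun _ => rfl) h
          simp only at h3
          subst h3
          have hj : (κ j, l) ∈ W := by simpa [s, siteState] using h4
          have hpostAdj : ∀ j, G.Adj (κ j) (ξ (cellPost j)) := fun j => by
            rw [hG, hπκ, hξ, G2_adj_siteCell_sitePost]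
          have hconn : Relation.ReflTransGen R (κ 0, 0) (κ j, l) := by
            rcases v with q | t
            · rcases ih.1 q rfl with ⟨hq, hl⟩ | ⟨i, hi, hiW, hc⟩
              · obtain rfl : l = 0 := hl
                obtain rfl : j = 0 := by
                  subst hq; clear * - hv; revert j; decide
                exact .refl
              · by_cases hij : i = j
                · rw [← hij]; exact hc
                · refine hc.tail ⟨hiW, hj, Or.inl ⟨rfl, ?_⟩⟩
                  rw [hG, hπκ, hπκ, G2_adj_siteCell]
                  change ChainMem j (.inl q) at hv
                  clear * - hv hi hij
                  revert q i j; decide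
            · obtain rfl := chainMem_inr.1 hv
              exact (ih.2 _ rfl l).tail ⟨hξW _ _, hj, Or.inl ⟨rfl, (hpostAdj j).symm⟩⟩
          refine ⟨fun q hq => Or.inr ⟨j, hq ▸ hw, hj, hconn⟩, fun t ht m => ?_⟩
          obtain rfl : w = .inr t := ht
          obtain rfl := chainMem_inr.1 hw
          have h5 := hconn.tail (⟨hj, hξW _ _, Or.inl ⟨rfl, hpostAdj j⟩⟩ : R _ (ξ (cellPost j), l))
          by_cases hlm : l = m
          · rw [← hlm]; exact h5
          · exact h5.tail ⟨hξW _ _, hξW _ _, Or.inr ⟨rfl, hlm⟩⟩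
        · simp only at h1 h2
          subst h1
          rcases v with q | t
          · simp [s, siteState, ChainState.Vert] at h2
          · exact ⟨by simp, ih.2⟩
    rcases (key _ h).1 6 rfl with ⟨h6, -⟩ | ⟨j, hj, -, hc⟩
    · exact absurd h6 (by decide)
    · obtain rfl : j = 5 := by
        clear * - hj; revert j; decide
      exact hc

end

theorem E2_prob_lt : (E2 G2 T2).prob (0, 0) (8, 0) < (E2 G2 T2).prob (0, 0) (8, 1) := by
  have : Finite (E2 G2 T2).Outcome := inferInstanceAs (Finite (Set (Fin 9 × Fin 2)))
  have hF : ∀ j, siteCell j ∉ T2 := fun j => notMem_T2_iff.2 ⟨j, rfl⟩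
  refine (E2 G2 T2).prob_lt_prob_of_layerState (y := fun i => (8, i))
    (layerSet_injective siteCell_injective hF)
    (range_layerSet siteCell_injective fun _ => notMem_T2_iff) fun c i => ?_
  have hs : siteState siteCell (layerSet T2 siteCell c) = layerState c := by
    simp [siteState, layerState, mem_layerSet siteCell_injective hF, beq_eq_decide]
  rw [← hs]
  refine conn_site_iff (π := id) (κ := siteCell) (fun _ _ => Iff.rfl) (fun _ _ => Iff.rfl)
    (fun t => ⟨sitePost t, rfl, fun l => Or.inl (sitePost_mem_T2 t)⟩) i

theorem nat_card_T2 : Nat.card T2 = 3 := by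
  rw [Nat.card_coe_set_eq, T2, Set.ncard_eq_toFinset_card']
  rfl

theorem nat_card_G1_vertex : Nat.card (BlowUpVertex T2 33) = 105 := by
  have h := Set.ncard_add_ncard_compl T2
  rw [← Nat.card_coe_set_eq, ← Nat.card_coe_set_eq, nat_card_T2, Nat.card_fin] at h
  rw [Nat.card_sum, Nat.card_prod, nat_card_T2, Nat.card_fin]
  omega

/-- The vertex of `G1` corresponding to a cell. -/
def blowUpCell (j : Fin 6) : BlowUpVertex T2 33 := .inl ⟨siteCell j, notMem_T2_iff.2 ⟨j, rfl⟩⟩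

def siteCoreVertex (p : Fin 6 × Fin 2) : BlowUpVertex T2 33 × Fin 2 := (blowUpCell p.1, p.2)

theorem siteCoreVertex_injective : Function.Injective siteCoreVertex := by
  rintro ⟨i, l⟩ ⟨j, m⟩ h
  obtain ⟨h1, h2⟩ := Prod.ext_iff.1 h
  exact Prod.ext (siteCell_injective (congrArg (blowUpProj T2 33) h1)) h2

def siteBlock (t : T2) (i : Fin 33) (l : Fin 2) : BlowUpVertex T2 33 × Fin 2 := (.inr (t, i), l)

theorem eq_blowUpCell_iff (j : Fin 6) (x : BlowUpVertex T2 33) :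
    blowUpProj T2 33 x = siteCell j ↔ x = blowUpCell j := by
  constructor
  · intro h
    rcases x with x | ⟨t, i⟩
    · exact congrArg Sum.inl (Subtype.ext h)
    · exact absurd t.2 (notMem_T2_iff.2 ⟨j, h⟩)
  · rintro rfl; rfl

theorem siteState_preimage (W : Set (BlowUpVertex T2 33 × Fin 2)) :
    siteState (fun j => j) (siteCoreVertex ⁻¹' W) = siteState blowUpCell W := rfl

theorem siteState_id_injective :
    Function.Injective (siteState fun j : Fin 6 => j) := by
  intro S S' h
  simp only [siteState, Prod.mk.injEq, and_true, funext_iff, decide_eq_decide] at h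
  ext ⟨j, l⟩
  exact h j l

theorem range_siteState_id : Set.range (siteState fun j : Fin 6 => j) =
    {s | (∀ j, (s.1 j).2 = (false, false)) ∧ ∀ q, s.2 q = false} := by
  ext s
  constructor
  · rintro ⟨S, rfl⟩; exact ⟨fun _ => rfl, fun _ => rfl⟩
  · rintro ⟨h, h'⟩
    refine ⟨{p | (s.1 p.1).1 p.2 = true}, ?_⟩
    exact Prod.ext (funext fun j => Prod.ext (funext fun l => by simp [siteState]) (h j).symm)
      (funext fun q => (h' q).symm)

theorem E1_prob_lt : (E1 G1).prob (G1start, 0) (G1target, 0) <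
    (E1 G1).prob (G1start, 0) (G1target, 1) := by
  have : Finite (E1 G1).Outcome := inferInstanceAs (Finite (Set (BlowUpVertex T2 33 × Fin 2)))
  have := Fintype.ofFinite T2
  apply (E1 G1).prob_lt_prob_of_univ rfl
  have hconn : ∀ i (W : Set (BlowUpVertex T2 33 × Fin 2)), (∀ t, ∃ j, ∀ x, siteBlock t j x ∈ W) →
      (Conn (bunkbed (ofGraph G1)) {e | ends (bunkbed (ofGraph G1)) e ⊆ W} (G1start, 0)
        (G1target, i) ↔ (siteState (fun j => j) (siteCoreVertex ⁻¹' W)).Hits i) := by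
    intro i W hW
    rw [siteState_preimage]
    refine conn_site_iff (π := blowUpProj T2 33) (fun _ _ => Iff.rfl) eq_blowUpCell_iff
      (fun t => ?_) i
    obtain ⟨k, hk⟩ := hW ⟨_, sitePost_mem_T2 t⟩
    exact ⟨_, rfl, hk⟩
  have hcount : ∀ i, {S | (siteState (fun j : Fin 6 => j) S).Hits i}.ncard =
      {s : ChainState | ((∀ j, (s.1 j).2 = (false, false)) ∧ ∀ q, s.2 q = false) ∧
        s.Hits i}.ncard := by
    intro i
    rw [← Set.ncard_image_of_injective _ siteState_id_injective]
    congr 1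
    refine (Set.image_preimage_eq_range_inter (t := {s : ChainState | s.Hits i})
      (f := siteState fun j : Fin 6 => j)).trans ?_
    rw [range_siteState_id]; rfl
  have h := ncard_lt_ncard_of_core (w := fun _ _ => 2) siteCoreVertex_injective siteBlock
    (by rintro t ⟨j, x⟩ ⟨j', x'⟩ h; simpa [siteBlock] using h)
    (by rintro t j x i h; cases congrArg Prod.fst h) (m := 1)
    (c₀ := fun S => (siteState (fun j : Fin 6 => j) S).Hits 0)
    (c₁ := fun S => (siteState (fun j : Fin 6 => j) S).Hits 1)
    (fun X hX h => (hconn 0 X hX).1 h) (fun X hX h => (hconn 1 X hX).2 h)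
    (by rw [hcount, hcount]; exact ncard_hits_undirected_of_not_vert) ?_
  · exact h
  · have h3 : Fintype.card T2 = 3 := by rw [← Nat.card_eq_fintype_card, nat_card_T2]
    have hI : Nat.card (Fin 6 × Fin 2) = 12 := by simp
    rw [hI]
    -- A blown-up post works if some vertex has both copies open, so the bound needed is `3 * (3 /
    -- 4) ^ 33 * (2 ^ 12 + 1) < 1`.
    norm_num [h3]

end Bunkbed

theorem theorem1 :
    -- the generalised bunkbed conjecture is false for each of the models
    (¬ ∀ (V : Type) [Finite V] (G : SimpleGraph V),
        Bunkbed.BunkbedConjecture (Bunkbed.E1 G)) ∧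
    (¬ ∀ (V : Type) [Finite V] (G : SimpleGraph V) (T : Set V),
        Bunkbed.BunkbedConjecture (Bunkbed.E2 G T)) ∧
    (¬ ∀ (α : Type) [Finite α] (H : Hypergraph α) (T : Set H.vertexSet),
        Bunkbed.BunkbedConjecture (Bunkbed.E4 H T)) ∧
    (¬ ∀ (α : Type) [Finite α] (H : Hypergraph α),
        Bunkbed.BunkbedConjecture (Bunkbed.E5 H)) ∧
    (¬ ∀ (V : Type) [Finite V] (D : Digraph V) (T : Set V) (F : Set (Bunkbed.DEdge D)),
        Bunkbed.BunkbedConjecture (Bunkbed.E6 D T F)) ∧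
    (¬ ∀ (V E : Type) [Finite V] [Finite E] (D : Bunkbed.MultiDigraph V E),
        Bunkbed.BunkbedConjecture (Bunkbed.E7 D)) ∧
    -- the explicit counterexample for unconditioned site percolation
    (Nat.card (Bunkbed.BlowUpVertex Bunkbed.T2 33) = 105 ∧
      (Bunkbed.E1 Bunkbed.G1).prob (Bunkbed.G1start, 0) (Bunkbed.G1target, 0) <
        (Bunkbed.E1 Bunkbed.G1).prob (Bunkbed.G1start, 0) (Bunkbed.G1target, 1)) ∧
    -- the explicit counterexample for conditioned site percolation
    ((Bunkbed.E2 Bunkbed.G2 Bunkbed.T2).prob (0, 0) (8, 0) <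
        (Bunkbed.E2 Bunkbed.G2 Bunkbed.T2).prob (0, 0) (8, 1)) ∧
    -- the explicit counterexample for conditioned hypergraphs
    ((Bunkbed.E4 Bunkbed.H4 {v | v.1 ∈ Bunkbed.T4}).prob
          (Bunkbed.H4vertex 0, 0) (Bunkbed.H4vertex 9, 0) <
        (Bunkbed.E4 Bunkbed.H4 {v | v.1 ∈ Bunkbed.T4}).prob
          (Bunkbed.H4vertex 0, 0) (Bunkbed.H4vertex 9, 1)) ∧
    -- the explicit counterexample for unconditioned hypergraphs
    (Nat.card Bunkbed.H5.vertexSet = 316 ∧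
      (Bunkbed.E5 Bunkbed.H5).prob (Bunkbed.H5vertex 0, 0) (Bunkbed.H5vertex 9, 0) <
        (Bunkbed.E5 Bunkbed.H5).prob (Bunkbed.H5vertex 0, 0) (Bunkbed.H5vertex 9, 1)) ∧
    -- the explicit counterexample for conditioned digraphs
    ((Bunkbed.E6 Bunkbed.D6 Bunkbed.T6 Bunkbed.F6).prob
          (Bunkbed.D6Vertex.old 0, 0) (Bunkbed.D6Vertex.old 9, 0) <
        (Bunkbed.E6 Bunkbed.D6 Bunkbed.T6 Bunkbed.F6).prob
          (Bunkbed.D6Vertex.old 0, 0) (Bunkbed.D6Vertex.old 9, 1)) ∧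
    -- the explicit counterexample for unconditioned directed multigraphs
    (Nat.card (Bunkbed.GadgetVertex Bunkbed.T6 690) = 2092 ∧
      (Bunkbed.E7 Bunkbed.D7).prob
          (Sum.inl (Bunkbed.D6Vertex.old 0), 0) (Sum.inl (Bunkbed.D6Vertex.old 9), 0) <
        (Bunkbed.E7 Bunkbed.D7).prob
          (Sum.inl (Bunkbed.D6Vertex.old 0), 0) (Sum.inl (Bunkbed.D6Vertex.old 9), 1)) :=
  ⟨fun h => Bunkbed.not_bunkbedConjecture Bunkbed.E1_prob_lt (h _ _),
    fun h => Bunkbed.not_bunkbedConjecture Bunkbed.E2_prob_lt (h _ _ _),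
    fun h => Bunkbed.not_bunkbedConjecture Bunkbed.E4_prob_lt (h _ _ _),
    fun h => Bunkbed.not_bunkbedConjecture Bunkbed.E5_prob_lt (h _ _),
    fun h => Bunkbed.not_bunkbedConjecture Bunkbed.E6_prob_lt (h _ _ _ _),
    fun h => Bunkbed.not_bunkbedConjecture Bunkbed.E7_prob_lt (h _ _ _),
    ⟨Bunkbed.nat_card_G1_vertex, Bunkbed.E1_prob_lt⟩, Bunkbed.E2_prob_lt, Bunkbed.E4_prob_lt,
    ⟨Bunkbed.nat_card_H5_vertexSet, Bunkbed.E5_prob_lt⟩, Bunkbed.E6_prob_lt,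
    ⟨Bunkbed.nat_card_D7_vertex, Bunkbed.E7_prob_lt⟩⟩
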